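/- Let $k\ge 1$ and $d$ be integers and let $\sigma=\mathrm{erf}$, $\mathrm{erf}(x)=\frac1{\sqrt\pi}\int_{-x}^{x}e^{-t^2}\,dt$. For $w_0\in\mathbb R^d$ and $x=(x_1,\dots,x_k)\in(\mathbb R^d)^k$ let $$p_{w_0}(x)=\sigma(w_0^\top x_1)+\prod_{l=1}^{k}\sigma(w_0^\top x_l),\qquad F_{u_0}(w_0)=\mathbb E_x\Big[\tfrac12\big(p_{w_0}(x)-p_{u_0}(x)\big)^2\Big],$$ where $x_1,\dots,x_k$ are i.i.d. standard Gaussian vectors in $\mathbb R^d$ and the target $u_0\in\mathbb R^d$ satisfies $\|u_0\|^2=\frac{12}{\pi^2}k^2$. Consider weight-sharing gradient descent with constant step size $\eta>0$, projected onto the ball of radius $\|u_0\|$: $$w_0^{(t+1)}=\Pi\big(w_0^{(t)}-\eta\nabla F_{u_0}(w_0^{(t)})\big),\qquad \|w_0^{(0)}\|\le\|u_0\|,$$ where $\Pi$ is the Euclidean projection onto $\{w:\|w\|\le\|u_0\|\}$ (if the unprojected iterates stay in this ball, this is plain gradient descent). Let $\alpha^{(t)}$ denote the angle between $u_0$ and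 $w_0^{(t)}$ (with the convention that it is $\pi/2$ if $w_0^{(t)}=0$). Theorem. There is a polynomial $P$ in two variables such that for every $k\ge1$ and $\epsilon>0$ there is a step size $\eta>0$, depending only on $k$ and $\epsilon$, with the following property. For every dimension $d$, every such $u_0$, every run of the above projected gradient descent with step size $\eta$, and every time $t'$ with $$\alpha^{(t')}<\min\Big\{\arctan\Big(\frac{\epsilon}{2\|u_0\|}\Big),\sqrt{\frac{\epsilon}{\|u_0\|}}\Big\},$$ there is a time $t$ with $t'\le t\le t'+P(k,1/\epsilon)$ and $\|w_0^{(t)}-u_0\|\le\epsilon$. -/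

import Mathlib

open MeasureTheory ProbabilityTheory

namespace WeightSharing

noncomputable section

/-- The error function `erf x = (1 / √π) ∫_{-x}^{x} exp (-t²) dt`, used as the activation `σ`. -/
def erf (x : ℝ) : ℝ := (1 / Real.sqrt Real.pi) * ∫ t in (-x)..x, Real.exp (-t ^ 2)

/-- The fully connected predictor `p_w^{(k)}(x) = ∏_l σ(⟨w_l, x_l⟩)`. -/
def predHigh {d k : ℕ} (w x : Fin k → EuclideanSpace ℝ (Fin d)) : ℝ :=
  ∏ l, erf (inner ℝ (w l) (x l))

/-- The predictor `p_w^{(1,k)}(x) = σ(⟨w_1, x_1⟩) + ∏_l σ(⟨w_l, x_l⟩)`, for `k ≥ 1`;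
the first input block has index `0`. -/
def predBoth {d k : ℕ} [NeZero k] (w x : Fin k → EuclideanSpace ℝ (Fin d)) : ℝ :=
  erf (inner ℝ (w 0) (x 0)) + predHigh w x

/-- The weight-sharing predictor: all `k` weight vectors equal `w₀`. -/
def predBothWS {d k : ℕ} [NeZero k] (w₀ : EuclideanSpace ℝ (Fin d))
    (x : Fin k → EuclideanSpace ℝ (Fin d)) : ℝ :=
  predBoth (fun _ => w₀) x

/-- The law of the input `x = (x_1, …, x_k)`: the blocks are i.i.d. standard Gaussian
vectors in `ℝ^d`. -/
def inputLaw (d k : ℕ) : Measure (Fin k → EuclideanSpace ℝ (Fin d)) :=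
  Measure.pi fun _ => stdGaussian (EuclideanSpace ℝ (Fin d))

/-- The weight-sharing objective
`F^{(1,k)}(w₀) = E_x [ (1/2) (p_{w₀}^{(1,k)}(x) - p_{u₀}^{(1,k)}(x))² ]`. -/
def objectiveWS {d : ℕ} (k : ℕ) [NeZero k] (u₀ w₀ : EuclideanSpace ℝ (Fin d)) : ℝ :=
  ∫ x, (1 / 2) * (predBothWS w₀ x - predBothWS u₀ x) ^ 2 ∂(inputLaw d k)

/-- The Euclidean projection onto the closed ball of radius `r ≥ 0` around the origin. -/
def projBall {d : ℕ} (r : ℝ) (w : EuclideanSpace ℝ (Fin d)) : EuclideanSpace ℝ (Fin d) :=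
  if ‖w‖ ≤ r then w else (r / ‖w‖) • w

/-- One step of gradient descent on the weight-sharing objective with step size `η`, followed
by the projection onto the ball of radius `‖u₀‖`. -/
def gdStep {d : ℕ} (k : ℕ) [NeZero k] (η : ℝ) (u₀ w : EuclideanSpace ℝ (Fin d)) :
    EuclideanSpace ℝ (Fin d) :=
  projBall ‖u₀‖ (w - η • gradient (objectiveWS k u₀) w)

end

end WeightSharing

namespace WeightSharing

/-! ### The error function -/

/-! The Gaussian average of a product of two erf neurons is an arcsine in closed form (`erfCorr`),
and the correlation of two predictors is a function `gain` of it. So the objective depends on `w`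
only through `‖w‖` and `⟨w, u⟩`, and its gradient is `contraction • w - attraction • u`. One step
therefore replaces `w` by a positive multiple of `(1 - η * contraction) • w + (η * attraction) • u`,
the projection only adding a positive scale.

While the angle is acute both coefficients are nonnegative and `contraction` is at most `4 * (k +
3)`, so for `η` of order `1 / k` the coefficient of `w` stays positive. Each step then divides the
bound `τ` on the tangent of the angle by a factor `1 + y` with `y` of order `1 / k ^ 3`
(`Aligned.gdStep`). Polynomially many steps make `τ` so small that the motion is essentially radial.

In that regime, as long as `⟨w, u⟩` is below `‖u‖ ^ 2 - ‖u‖ * ε / 2`, the attraction beats the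
contraction by a definite amount (`Aligned.le_drift`). This uses that `w` then correlates at least
as well with `u` as with itself (`Aligned.erfCorr_self_le`), and that the derivative of `gain` is
monotone on nonnegative arguments. Hence `⟨w, u⟩` grows linearly until it passes the threshold; an
active projection puts it there at once. Small angle and large inner product together give `‖w - u‖
≤ ε` (`Aligned.norm_sub_le`). -/

lemma erf_neg (x : ℝ) : erf (-x) = -erf x := by
  simp only [erf, neg_neg]
  rw [intervalIntegral.integral_symm]
  ring

lemma hasDerivAt_erf (x : ℝ) : HasDerivAt erf (2 / √Real.pi * Real.exp (-x ^ 2)) x := by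
  have hc : Continuous fun t : ℝ => Real.exp (-t ^ 2) := by fun_prop
  have h1 : ∀ y : ℝ, HasDerivAt (fun y => ∫ t in (0 : ℝ)..y, Real.exp (-t ^ 2))
      (Real.exp (-y ^ 2)) y := fun y => hc.integral_hasStrictDerivAt 0 y |>.hasDerivAt
  have h2 := ((h1 x).sub ((h1 (-x)).comp x (hasDerivAt_neg x))).const_mul (1 / √Real.pi)
  have h3 : erf = fun x => 1 / √Real.pi * ((fun y => ∫ t in (0 : ℝ)..y, Real.exp (-t ^ 2)) x -
      ((fun y => ∫ t in (0 : ℝ)..y, Real.exp (-t ^ 2)) ∘ Neg.neg) x) := by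
    funext y
    simp only [erf, Function.comp]
    rw [intervalIntegral.integral_interval_sub_left (hc.intervalIntegrable _ _)
      (hc.intervalIntegrable _ _)]
  rw [h3]
  refine h2.congr_deriv ?_
  rw [neg_sq]
  ring

lemma _root_.HasDerivAt.erf {f : ℝ → ℝ} {f' x : ℝ} (hf : HasDerivAt f f' x) :
    HasDerivAt (fun x => erf (f x)) (2 / √Real.pi * Real.exp (-(f x) ^ 2) * f') x :=
  (hasDerivAt_erf (f x)).comp x hf

@[fun_prop]
lemma continuous_erf : Continuous erf :=
  continuous_iff_continuousAt.2 fun x => (hasDerivAt_erf x).continuousAt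

@[fun_prop]
lemma measurable_erf : Measurable erf := continuous_erf.measurable

lemma erf_zero : erf 0 = 0 := by simp [erf]

lemma abs_erf_le_one (x : ℝ) : |erf x| ≤ 1 := by
  have hi : Integrable fun t : ℝ => Real.exp (-t ^ 2) := by
    simpa using integrable_exp_neg_mul_sq (b := 1) one_pos
  have h1 : |∫ t in (-x)..x, Real.exp (-t ^ 2)| ≤ √Real.pi := by
    have h := intervalIntegral.norm_integral_le_integral_norm_uIoc
      (f := fun t : ℝ => Real.exp (-t ^ 2)) (a := -x) (b := x) (μ := volume)
    simp only [Real.norm_eq_abs, Real.abs_exp] at h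
    refine h.trans ?_
    have h2 := integral_gaussian 1
    simp only [neg_mul, one_mul, div_one] at h2
    rw [← h2]
    exact setIntegral_le_integral hi (Filter.Eventually.of_forall fun t => (Real.exp_pos _).le)
  have hp : 0 < √Real.pi := Real.sqrt_pos.2 Real.pi_pos
  rw [erf, abs_mul, abs_of_pos (by positivity)]
  calc 1 / √Real.pi * _ ≤ 1 / √Real.pi * √Real.pi := by gcongr
    _ = 1 := by field_simp

/-! ### Gaussian averages of the error function -/

lemma integral_gaussianReal_zero_one (f : ℝ → ℝ) :
    ∫ z, f z ∂(gaussianReal 0 1) = (√(2 * Real.pi))⁻¹ * ∫ z, Real.exp (-(1 / 2) * z ^ 2) * f z := by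
  rw [integral_gaussianReal_eq_integral_smul one_ne_zero, ← integral_const_mul]
  congr 1
  funext z
  simp only [gaussianPDFReal, NNReal.coe_one, mul_one, sub_zero, smul_eq_mul]
  rw [show -z ^ 2 / 2 = -(1 / 2) * z ^ 2 by ring]
  ring

lemma integral_odd_gaussianReal {f : ℝ → ℝ} (hf : ∀ x, f (-x) = -f x) (v : NNReal) :
    ∫ z, f z ∂(gaussianReal 0 v) = 0 := by
  have h : ∫ z, f z ∂(gaussianReal 0 v) = ∫ z, f (-z) ∂(gaussianReal 0 v) := by
    conv_lhs => rw [show gaussianReal 0 v = (gaussianReal 0 v).map (fun x => -x) by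
      rw [gaussianReal_map_neg, neg_zero]]
    exact integral_map_equiv (MeasurableEquiv.neg ℝ) f
  simp only [hf, integral_neg] at h
  linarith

lemma integrable_of_abs_le {α : Type*} [MeasurableSpace α] {μ : Measure α} [IsFiniteMeasure μ]
    {f : α → ℝ} (hf : Measurable f) {C : ℝ} (hC : ∀ x, |f x| ≤ C) : Integrable f μ :=
  Integrable.of_bound hf.aestronglyMeasurable C (Filter.Eventually.of_forall hC)

lemma integral_exp_neg_add_mul_sq (c σ : ℝ) :
    ∫ z, Real.exp (-(c + σ * z) ^ 2) ∂(gaussianReal 0 1) =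
      Real.exp (-(c / √(1 + 2 * σ ^ 2)) ^ 2) * (1 / √(1 + 2 * σ ^ 2)) := by
  have hS : 0 < 1 + 2 * σ ^ 2 := by positivity
  rw [integral_gaussianReal_zero_one]
  have h1 : ∀ z : ℝ, Real.exp (-(1 / 2) * z ^ 2) * Real.exp (-(c + σ * z) ^ 2) =
      Real.exp (-(c / √(1 + 2 * σ ^ 2)) ^ 2) *
        (fun z => Real.exp (-(σ ^ 2 + 1 / 2) * z ^ 2)) (z + c * σ / (σ ^ 2 + 1 / 2)) := by
    intro z
    simp only
    rw [← Real.exp_add, ← Real.exp_add, div_pow, Real.sq_sqrt hS.le]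
    congr 1
    field_simp
    ring
  simp_rw [h1]
  rw [integral_const_mul, integral_add_right_eq_self
    (fun z => Real.exp (-(σ ^ 2 + 1 / 2) * z ^ 2)), integral_gaussian]
  have h2 : Real.pi / (σ ^ 2 + 1 / 2) = (2 * Real.pi) / (1 + 2 * σ ^ 2) := by
    field_simp
    ring
  rw [h2, Real.sqrt_div (by positivity)]
  have : √(2 * Real.pi) ≠ 0 := by positivity
  field_simp

/-- Both sides have the same derivative in `c`, by the Gaussian integral obtained from completing
the square, and both vanish at `c = 0` by oddness. -/
lemma integral_erf_add_mul (c σ : ℝ) :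
    ∫ z, erf (c + σ * z) ∂(gaussianReal 0 1) = erf (c / √(1 + 2 * σ ^ 2)) := by
  set s := √(1 + 2 * σ ^ 2) with hs
  have hd : ∀ c, HasDerivAt (fun c => ∫ z, erf (c + σ * z) ∂(gaussianReal 0 1))
      (∫ z, 2 / √Real.pi * Real.exp (-(c + σ * z) ^ 2) ∂(gaussianReal 0 1)) c := by
    intro c
    refine (hasDerivAt_integral_of_dominated_loc_of_deriv_le (s := Set.univ)
      (F := fun c z => erf (c + σ * z))
      (F' := fun c z => 2 / √Real.pi * Real.exp (-(c + σ * z) ^ 2))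
      (bound := fun _ => 2 / √Real.pi) Filter.univ_mem ?_ ?_ ?_ ?_ ?_ ?_).2
    · exact Filter.Eventually.of_forall fun c => by fun_prop
    · exact integrable_of_abs_le (by fun_prop) fun x => abs_erf_le_one _
    · fun_prop
    · refine Filter.Eventually.of_forall fun z c _ => ?_
      rw [Real.norm_eq_abs, abs_of_nonneg (by positivity)]
      exact mul_le_of_le_one_right (by positivity) (Real.exp_le_one_iff.2 (by nlinarith))
    · exact integrable_const _
    · refine Filter.Eventually.of_forall fun z c _ => ?_
      simpa using ((hasDerivAt_id c).add_const (σ * z)).erf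
  have hd2 : ∀ c, HasDerivAt (fun c => erf (c / s))
      (∫ z, 2 / √Real.pi * Real.exp (-(c + σ * z) ^ 2) ∂(gaussianReal 0 1)) c := by
    intro c
    rw [integral_const_mul, integral_exp_neg_add_mul_sq, ← mul_assoc]
    exact ((hasDerivAt_id c).div_const s).erf
  refine congrFun (eq_of_fderiv_eq (𝕜 := ℝ) (fun c => (hd c).differentiableAt)
    (fun c => (hd2 c).differentiableAt) (fun c => ?_) 0 ?_) c
  · rw [(hd c).hasFDerivAt.fderiv, (hd2 c).hasFDerivAt.fderiv]
  · simp only [zero_add, zero_div, erf_zero]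
    exact integral_odd_gaussianReal (fun x => by rw [mul_neg, erf_neg]) 1

/-- Integration by parts: with the Gaussian density absorbed into `β`, the derivative of `exp (-β
y²) erf (a y)` has integral zero. -/
lemma integral_mul_exp_mul_erf (a κ : ℝ) :
    ∫ y, y * Real.exp (-(κ * y) ^ 2) * erf (a * y) ∂(gaussianReal 0 1) =
      2 * a / √Real.pi / ((1 + 2 * κ ^ 2) * √(1 + 2 * a ^ 2 + 2 * κ ^ 2)) := by
  set β := κ ^ 2 + 1 / 2 with hβ
  have hβ0 : 0 < β := by positivity
  rw [integral_gaussianReal_zero_one]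
  have h1 : ∀ y : ℝ, Real.exp (-(1 / 2) * y ^ 2) * (y * Real.exp (-(κ * y) ^ 2) * erf (a * y)) =
      y * Real.exp (-β * y ^ 2) * erf (a * y) := by
    intro y
    rw [show -β * y ^ 2 = -(1 / 2) * y ^ 2 + -(κ * y) ^ 2 by rw [hβ]; ring, Real.exp_add]
    ring
  simp_rw [h1]
  have hi1 : Integrable fun y : ℝ => y * Real.exp (-β * y ^ 2) * erf (a * y) := by
    refine (integrable_mul_exp_neg_mul_sq hβ0).mul_bdd (c := 1) (by fun_prop) ?_
    exact Filter.Eventually.of_forall fun y => abs_erf_le_one _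
  have hi2 : Integrable fun y : ℝ => Real.exp (-(β + a ^ 2) * y ^ 2) :=
    integrable_exp_neg_mul_sq (by positivity)
  have hi3 : Integrable fun y : ℝ => Real.exp (-β * y ^ 2) * erf (a * y) := by
    refine (integrable_exp_neg_mul_sq hβ0).mul_bdd (c := 1) (by fun_prop) ?_
    exact Filter.Eventually.of_forall fun y => abs_erf_le_one _
  have hd : ∀ y : ℝ, HasDerivAt (fun y : ℝ => Real.exp (-β * y ^ 2) * erf (a * y))
      (-(2 * β) * (y * Real.exp (-β * y ^ 2) * erf (a * y)) +
        2 * a / √Real.pi * Real.exp (-(β + a ^ 2) * y ^ 2)) y := by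
    intro y
    have e1 : HasDerivAt (fun y : ℝ => Real.exp (-β * y ^ 2))
        (Real.exp (-β * y ^ 2) * (-β * (2 * y))) y := by
      simpa using ((hasDerivAt_pow 2 y).const_mul (-β)).exp
    have e2 : HasDerivAt (fun y : ℝ => erf (a * y))
        (2 / √Real.pi * Real.exp (-(a * y) ^ 2) * a) y := by
      simpa using ((hasDerivAt_id y).const_mul a).erf
    refine (e1.mul e2).congr_deriv ?_
    rw [show -(β + a ^ 2) * y ^ 2 = -β * y ^ 2 + -(a * y) ^ 2 by ring, Real.exp_add]
    ring
  have h2 := integral_eq_zero_of_hasDerivAt_of_integrable hd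
    ((hi1.const_mul _).add (hi2.const_mul _)) hi3
  rw [integral_add (hi1.const_mul _) (hi2.const_mul _), integral_const_mul, integral_const_mul,
    integral_gaussian] at h2
  have h3 : Real.pi / (β + a ^ 2) = 2 * Real.pi / (1 + 2 * a ^ 2 + 2 * κ ^ 2) := by
    rw [hβ]
    field_simp
    ring
  rw [h3, Real.sqrt_div (by positivity)] at h2
  have h4 : 1 + 2 * κ ^ 2 = 2 * β := by rw [hβ]; ring
  rw [h4]
  have h5 : ∫ y, y * Real.exp (-β * y ^ 2) * erf (a * y) =
      2 * a / √Real.pi * (√(2 * Real.pi) / √(1 + 2 * a ^ 2 + 2 * κ ^ 2)) / (2 * β) := by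
    rw [eq_div_iff (by positivity)]
    linarith
  rw [h5]
  have : √(2 * Real.pi) ≠ 0 := by positivity
  field_simp

lemma hasDerivAt_arcsin_ratio (a κ : ℝ) :
    HasDerivAt (fun κ => Real.arcsin (2 * a * κ / √((1 + 2 * a ^ 2) * (1 + 2 * κ ^ 2))))
      (2 * a / ((1 + 2 * κ ^ 2) * √(1 + 2 * a ^ 2 + 2 * κ ^ 2))) κ := by
  have hA : 0 < 1 + 2 * a ^ 2 := by positivity
  have hB : 0 < 1 + 2 * κ ^ 2 := by positivity
  have hD : 0 < 1 + 2 * a ^ 2 + 2 * κ ^ 2 := by positivity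
  set z := 2 * a * κ / √((1 + 2 * a ^ 2) * (1 + 2 * κ ^ 2)) with hz
  have hz2 : 1 - z ^ 2 = (1 + 2 * a ^ 2 + 2 * κ ^ 2) / ((1 + 2 * a ^ 2) * (1 + 2 * κ ^ 2)) := by
    rw [hz, div_pow, Real.sq_sqrt (by positivity)]
    field_simp
    ring
  have hlt : z ^ 2 < 1 := by
    have : 0 < 1 - z ^ 2 := by rw [hz2]; positivity
    linarith
  have hz1 : |z| < 1 := (sq_lt_one_iff_abs_lt_one z).1 hlt
  have e1 : HasDerivAt (fun κ : ℝ => (1 + 2 * a ^ 2) * (1 + 2 * κ ^ 2))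
      ((1 + 2 * a ^ 2) * (2 * (2 * κ))) κ := by
    simpa using (((hasDerivAt_pow 2 κ).const_mul 2).const_add 1).const_mul (1 + 2 * a ^ 2)
  have e2 := ((hasDerivAt_id κ).const_mul (2 * a)).div (e1.sqrt (by positivity)) (by positivity)
  have e3 := (Real.hasDerivAt_arcsin (x := z) (abs_lt.1 hz1).1.ne' (abs_lt.1 hz1).2.ne).comp κ e2
  refine e3.congr_deriv ?_
  rw [hz2, Real.sqrt_div hD.le, Real.sqrt_mul hA.le]
  simp only [id, mul_one]
  have q1 := Real.sq_sqrt hA.le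
  have q2 := Real.sq_sqrt hB.le
  have p1 := Real.sqrt_pos.2 hA
  have p2 := Real.sqrt_pos.2 hB
  have p3 := Real.sqrt_pos.2 hD
  set x := √(1 + 2 * a ^ 2)
  set y := √(1 + 2 * κ ^ 2)
  rw [← q1, ← q2]
  field_simp
  linear_combination a * q2

/-- Both sides vanish at `κ = 0`, and their derivatives in `κ` agree by the two preceding lemmas. -/
lemma integral_erf_mul_erf (a κ : ℝ) :
    ∫ y, erf (a * y) * erf (κ * y) ∂(gaussianReal 0 1) =
      2 / Real.pi * Real.arcsin (2 * a * κ / √((1 + 2 * a ^ 2) * (1 + 2 * κ ^ 2))) := by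
  have hd : ∀ κ, HasDerivAt (fun κ => ∫ y, erf (a * y) * erf (κ * y) ∂(gaussianReal 0 1))
      (∫ y, 2 / √Real.pi * (y * Real.exp (-(κ * y) ^ 2) * erf (a * y)) ∂(gaussianReal 0 1)) κ := by
    intro κ
    refine (hasDerivAt_integral_of_dominated_loc_of_deriv_le (s := Set.univ)
      (F := fun κ y => erf (a * y) * erf (κ * y))
      (F' := fun κ y => 2 / √Real.pi * (y * Real.exp (-(κ * y) ^ 2) * erf (a * y)))
      (bound := fun y => 2 / √Real.pi * |y|) Filter.univ_mem ?_ ?_ ?_ ?_ ?_ ?_).2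
    · exact Filter.Eventually.of_forall fun c => by fun_prop
    · refine integrable_of_abs_le (C := 1) (by fun_prop) fun x => ?_
      rw [abs_mul]
      exact mul_le_one₀ (abs_erf_le_one _) (abs_nonneg _) (abs_erf_le_one _)
    · fun_prop
    · refine Filter.Eventually.of_forall fun y κ _ => ?_
      rw [Real.norm_eq_abs, abs_mul, abs_mul, abs_mul, Real.abs_exp, abs_of_nonneg (by positivity)]
      have h1 : Real.exp (-(κ * y) ^ 2) ≤ 1 := Real.exp_le_one_iff.2 (by nlinarith)
      calc 2 / √Real.pi * (|y| * Real.exp (-(κ * y) ^ 2) * |erf (a * y)|)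
          ≤ 2 / √Real.pi * (|y| * 1 * 1) := by
            gcongr
            exact abs_erf_le_one _
        _ = _ := by ring
    · have h : Integrable (fun y : ℝ => y) (gaussianReal 0 1) := IsGaussian.integrable_id
      exact h.abs.const_mul _
    · refine Filter.Eventually.of_forall fun y κ _ => ?_
      have := ((hasDerivAt_id κ).mul_const y).erf.const_mul (erf (a * y))
      refine this.congr_deriv ?_
      simp only [id]
      ring
  have hd2 : ∀ κ, HasDerivAt (fun κ => 2 / Real.pi *
      Real.arcsin (2 * a * κ / √((1 + 2 * a ^ 2) * (1 + 2 * κ ^ 2))))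
      (∫ y, 2 / √Real.pi * (y * Real.exp (-(κ * y) ^ 2) * erf (a * y)) ∂(gaussianReal 0 1)) κ := by
    intro κ
    rw [integral_const_mul, integral_mul_exp_mul_erf]
    refine ((hasDerivAt_arcsin_ratio a κ).const_mul (2 / Real.pi)).congr_deriv ?_
    have h := Real.sq_sqrt Real.pi_pos.le
    have h' := Real.sqrt_pos.2 Real.pi_pos
    nth_rewrite 1 [← h]
    field_simp
  refine congrFun (eq_of_fderiv_eq (𝕜 := ℝ) (fun c => (hd c).differentiableAt)
    (fun c => (hd2 c).differentiableAt) (fun c => ?_) 0 ?_) κ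
  · rw [(hd c).hasFDerivAt.fderiv, (hd2 c).hasFDerivAt.fderiv]
  · simp [erf_zero]

/-! ### The correlation of two error function neurons -/

/-- The correlation `E[erf ⟨w, x⟩ erf ⟨v, x⟩]` under the standard Gaussian law, in closed form. -/
noncomputable def erfCorr {d : ℕ} (w v : EuclideanSpace ℝ (Fin d)) : ℝ :=
  2 / Real.pi * Real.arcsin (2 * inner ℝ w v / √((1 + 2 * ‖w‖ ^ 2) * (1 + 2 * ‖v‖ ^ 2)))

lemma erfCorr_comm {d : ℕ} (w v : EuclideanSpace ℝ (Fin d)) : erfCorr w v = erfCorr v w := by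
  rw [erfCorr, erfCorr, real_inner_comm, mul_comm (1 + 2 * ‖w‖ ^ 2)]

lemma stdGaussian_map_inner {d : ℕ} (w : EuclideanSpace ℝ (Fin d)) :
    (stdGaussian (EuclideanSpace ℝ (Fin d))).map (fun x => inner ℝ w x) =
      (gaussianReal 0 1).map (fun y => ‖w‖ * y) := by
  have h := IsGaussian.map_eq_gaussianReal (μ := stdGaussian (EuclideanSpace ℝ (Fin d)))
    (innerSL ℝ w)
  rw [integral_strongDual_stdGaussian, variance_dual_stdGaussian, innerSL_apply_norm] at h
  rw [gaussianReal_map_const_mul, mul_zero, mul_one]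
  refine h.trans ?_
  congr 1
  exact Real.toNNReal_of_nonneg (sq_nonneg _)

/-- Orthogonality makes the two jointly Gaussian projections uncorrelated, hence independent;
boundedness of `f` allows Fubini. -/
lemma integral_comp_inner_mul_inner {d : ℕ} (w v : EuclideanSpace ℝ (Fin d))
    (hwv : inner ℝ w v = 0) {f : ℝ → ℝ → ℝ} (hf : Measurable (Function.uncurry f))
    {C : ℝ} (hC : ∀ y z, |f y z| ≤ C) :
    ∫ x, f (inner ℝ w x) (inner ℝ v x) ∂(stdGaussian (EuclideanSpace ℝ (Fin d))) =
      ∫ y, ∫ z, f (‖w‖ * y) (‖v‖ * z) ∂(gaussianReal 0 1) ∂(gaussianReal 0 1) := by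
  set μ := stdGaussian (EuclideanSpace ℝ (Fin d))
  have hlaw : HasGaussianLaw (fun x => (inner ℝ w x, inner ℝ v x)) μ :=
    (IsGaussian.hasGaussianLaw_id (μ := μ)).map_fun ((innerSL ℝ w).prod (innerSL ℝ v))
  have hcov : cov[fun x => inner ℝ w x, fun x => inner ℝ v x; μ] = 0 := by
    rw [← covarianceBilin_apply_eq_cov IsGaussian.memLp_two_id, covarianceBilin_stdGaussian]
    exact hwv
  have hind := hlaw.indepFun_of_covariance_eq_zero hcov
  rw [indepFun_iff_map_prod_eq_prod_map_map (by fun_prop) (by fun_prop), stdGaussian_map_inner,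
    stdGaussian_map_inner] at hind
  have h1 : ∫ x, f (inner ℝ w x) (inner ℝ v x) ∂μ =
      ∫ q, Function.uncurry f q ∂(μ.map fun x => (inner ℝ w x, inner ℝ v x)) := by
    rw [integral_map (Measurable.aemeasurable (by fun_prop)) hf.aestronglyMeasurable]
    rfl
  rw [h1, hind, Measure.map_prod_map _ _ (by fun_prop) (by fun_prop),
    integral_map (Measurable.aemeasurable (by fun_prop)) hf.aestronglyMeasurable, integral_prod]
  · rfl
  · exact integrable_of_abs_le (C := C) (hf.comp (by fun_prop)) fun q => hC _ _

/-- Split `v = b • w + v'` with `v'` orthogonal to `w`. Averaging over the `v'` direction turns the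
second neuron into a rescaled erf of `⟨w, x⟩`, which leaves a one-dimensional integral. -/
lemma integral_erf_inner_mul_erf_inner {d : ℕ} (w v : EuclideanSpace ℝ (Fin d)) :
    ∫ x, erf (inner ℝ w x) * erf (inner ℝ v x) ∂(stdGaussian (EuclideanSpace ℝ (Fin d))) =
      erfCorr w v := by
  rcases eq_or_ne w 0 with rfl | hw
  · simp [erf_zero, erfCorr]
  have ha : 0 < ‖w‖ := norm_pos_iff.2 hw
  set b := inner ℝ w v / ‖w‖ ^ 2 with hb
  set v' := v - b • w with hv'
  have hbp : inner ℝ w v = b * ‖w‖ ^ 2 := by rw [hb]; field_simp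
  have horth : inner ℝ w v' = 0 := by
    rw [hv', inner_sub_right, inner_smul_right, real_inner_self_eq_norm_sq, hbp, sub_self]
  have hnorm : ‖v‖ ^ 2 = b ^ 2 * ‖w‖ ^ 2 + ‖v'‖ ^ 2 := by
    have h : v = b • w + v' := by rw [hv']; abel
    rw [h, norm_add_sq_real, inner_smul_left, horth, norm_smul, mul_pow, Real.norm_eq_abs, sq_abs]
    simp
  have h1 : ∀ x, erf (inner ℝ w x) * erf (inner ℝ v x) =
      (fun y z => erf y * erf (b * y + z)) (inner ℝ w x) (inner ℝ v' x) := by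
    intro x
    simp only [hv', inner_sub_left, inner_smul_left]
    simp
  simp_rw [h1]
  rw [integral_comp_inner_mul_inner w v' horth (C := 1)
    (f := fun y z => erf y * erf (b * y + z)) (by fun_prop) fun y z => ?_]
  · simp only [integral_const_mul]
    have hS : 0 < 1 + 2 * ‖v'‖ ^ 2 := by positivity
    have h2 : ∀ y, ∫ z, erf (b * (‖w‖ * y) + ‖v'‖ * z) ∂(gaussianReal 0 1) =
        erf (b * ‖w‖ / √(1 + 2 * ‖v'‖ ^ 2) * y) := by
      intro y
      rw [integral_erf_add_mul]
      congr 1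
      ring
    simp_rw [h2]
    rw [integral_erf_mul_erf, erfCorr]
    congr 2
    have h3 : (1 + 2 * ‖w‖ ^ 2) * (1 + 2 * (b * ‖w‖ / √(1 + 2 * ‖v'‖ ^ 2)) ^ 2) =
        (1 + 2 * ‖w‖ ^ 2) * (1 + 2 * ‖v‖ ^ 2) / (1 + 2 * ‖v'‖ ^ 2) := by
      rw [div_pow, Real.sq_sqrt hS.le, hnorm]
      field_simp
      ring
    rw [h3, Real.sqrt_div (by positivity), hbp]
    have := Real.sqrt_pos.2 hS
    field_simp
  · rw [abs_mul]
    exact mul_le_one₀ (abs_erf_le_one _) (abs_nonneg _) (abs_erf_le_one _)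

lemma integral_erf_inner {d : ℕ} (w : EuclideanSpace ℝ (Fin d)) :
    ∫ x, erf (inner ℝ w x) ∂(stdGaussian (EuclideanSpace ℝ (Fin d))) = 0 := by
  have h := integral_map (μ := stdGaussian (EuclideanSpace ℝ (Fin d)))
    (φ := fun x => inner ℝ w x) (f := erf) (Measurable.aemeasurable (by fun_prop))
    measurable_erf.aestronglyMeasurable
  rw [← h, stdGaussian_map_inner, gaussianReal_map_const_mul, mul_zero]
  exact integral_odd_gaussianReal erf_neg _

/-! ### The objective in closed form -/

/-- The coefficient of the linear term of `gain k`. -/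
noncomputable def gainCoeff (k : ℕ) : ℝ := if k = 1 then 3 else 1

/-- The correlation `E[p_w p_v]` of two predictors as a function of the correlation
`E[erf ⟨w, x⟩ erf ⟨v, x⟩]` of the neurons. -/
noncomputable def gain (k : ℕ) (s : ℝ) : ℝ := gainCoeff k * s + s ^ k

instance isProbabilityMeasure_inputLaw (d k : ℕ) : IsProbabilityMeasure (inputLaw d k) := by
  unfold inputLaw
  infer_instance

/-- For `k ≥ 2` block `1` contributes the mean of an odd function, so the cross terms vanish. For `k
= 1` both cross terms survive, which is why `gainCoeff 1` is `3 = 1 + 2`. -/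
lemma integral_erf_mul_predHigh {d k : ℕ} [NeZero k] (w v : EuclideanSpace ℝ (Fin d)) :
    ∫ x, erf (inner ℝ w (x 0)) * predHigh (fun _ => v) x ∂(inputLaw d k) =
      if k = 1 then erfCorr w v else 0 := by
  have h1 : ∀ x : Fin k → EuclideanSpace ℝ (Fin d),
      erf (inner ℝ w (x 0)) * predHigh (fun _ => v) x =
        ∏ l, (if l = 0 then erf (inner ℝ w (x l)) else 1) * erf (inner ℝ v (x l)) := by
    intro x
    rw [Finset.prod_mul_distrib, predHigh, Finset.prod_ite_eq' Finset.univ (0 : Fin k)]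
    simp
  simp_rw [h1]
  rw [inputLaw, integral_fintype_prod_eq_prod
    (f := fun l y => (if l = 0 then erf (inner ℝ w y) else 1) * erf (inner ℝ v y))]
  split_ifs with hk
  · subst hk
    rw [Fintype.prod_subsingleton _ 0]
    simpa using integral_erf_inner_mul_erf_inner w v
  · have hk0 : k ≠ 0 := NeZero.ne k
    have h2 : ((⟨1, by omega⟩ : Fin k)) ≠ 0 := by
      intro h
      have := congrArg Fin.val h
      simp at this
    refine Finset.prod_eq_zero (Finset.mem_univ (⟨1, by omega⟩ : Fin k)) ?_
    simp only [h2, if_false, one_mul]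
    exact integral_erf_inner v

lemma measurable_predHigh {d k : ℕ} (v : EuclideanSpace ℝ (Fin d)) :
    Measurable fun x : Fin k → EuclideanSpace ℝ (Fin d) => predHigh (fun _ => v) x := by
  unfold predHigh
  fun_prop

lemma abs_predHigh_le_one {d k : ℕ} (v : EuclideanSpace ℝ (Fin d))
    (x : Fin k → EuclideanSpace ℝ (Fin d)) : |predHigh (fun _ => v) x| ≤ 1 := by
  rw [predHigh, Finset.abs_prod]
  exact Finset.prod_le_one (fun _ _ => abs_nonneg _) fun _ _ => abs_erf_le_one _

lemma integrable_mul_of_abs_le_one {α : Type*} [MeasurableSpace α] {μ : Measure α}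
    [IsFiniteMeasure μ] {f g : α → ℝ} (hf : Measurable f) (hg : Measurable g)
    (hf1 : ∀ x, |f x| ≤ 1) (hg1 : ∀ x, |g x| ≤ 1) : Integrable (fun x => f x * g x) μ :=
  integrable_of_abs_le (C := 1) (hf.mul hg) fun x => by
    rw [abs_mul]
    exact mul_le_one₀ (hf1 x) (abs_nonneg _) (hg1 x)

lemma measurable_erf_inner {d k : ℕ} [NeZero k] (v : EuclideanSpace ℝ (Fin d)) :
    Measurable fun x : Fin k → EuclideanSpace ℝ (Fin d) => erf (inner ℝ v (x 0)) := by
  fun_prop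

lemma predBothWS_mul_eq {d k : ℕ} [NeZero k] (w v : EuclideanSpace ℝ (Fin d))
    (x : Fin k → EuclideanSpace ℝ (Fin d)) :
    predBothWS w x * predBothWS v x =
      (erf (inner ℝ w (x 0)) * erf (inner ℝ v (x 0)) +
        predHigh (fun _ => w) x * predHigh (fun _ => v) x) +
      (erf (inner ℝ w (x 0)) * predHigh (fun _ => v) x +
        erf (inner ℝ v (x 0)) * predHigh (fun _ => w) x) := by
  simp only [predBothWS, predBoth]
  ring

lemma integrable_predBothWS_mul {d k : ℕ} [NeZero k] (w v : EuclideanSpace ℝ (Fin d)) :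
    Integrable (fun x => predBothWS w x * predBothWS v x) (inputLaw d k) := by
  simp_rw [predBothWS_mul_eq]
  refine Integrable.add (Integrable.add ?_ ?_) (Integrable.add ?_ ?_)
  · exact integrable_mul_of_abs_le_one (measurable_erf_inner w) (measurable_erf_inner v)
      (fun _ => abs_erf_le_one _) fun _ => abs_erf_le_one _
  · exact integrable_mul_of_abs_le_one (measurable_predHigh w) (measurable_predHigh v)
      (fun _ => abs_predHigh_le_one _ _) fun _ => abs_predHigh_le_one _ _
  · exact integrable_mul_of_abs_le_one (measurable_erf_inner w) (measurable_predHigh v)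
      (fun _ => abs_erf_le_one _) fun _ => abs_predHigh_le_one _ _
  · exact integrable_mul_of_abs_le_one (measurable_erf_inner v) (measurable_predHigh w)
      (fun _ => abs_erf_le_one _) fun _ => abs_predHigh_le_one _ _

lemma integral_predBothWS_mul {d k : ℕ} [NeZero k] (w v : EuclideanSpace ℝ (Fin d)) :
    ∫ x, predBothWS w x * predBothWS v x ∂(inputLaw d k) = gain k (erfCorr w v) := by
  have i1 := integrable_mul_of_abs_le_one (μ := inputLaw d k)
    (measurable_erf_inner w) (measurable_erf_inner v)
    (fun _ => abs_erf_le_one _) fun _ => abs_erf_le_one _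
  have i2 := integrable_mul_of_abs_le_one (μ := inputLaw d k)
    (measurable_predHigh w) (measurable_predHigh v)
    (fun _ => abs_predHigh_le_one _ _) fun _ => abs_predHigh_le_one _ _
  have i3 := integrable_mul_of_abs_le_one (μ := inputLaw d k)
    (measurable_erf_inner w) (measurable_predHigh v)
    (fun _ => abs_erf_le_one _) fun _ => abs_predHigh_le_one _ _
  have i4 := integrable_mul_of_abs_le_one (μ := inputLaw d k)
    (measurable_erf_inner v) (measurable_predHigh w)
    (fun _ => abs_erf_le_one _) fun _ => abs_predHigh_le_one _ _
  simp_rw [predBothWS_mul_eq]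
  rw [integral_add ?_ ?_, integral_add i1 i2, integral_add i3 i4,
    integral_erf_mul_predHigh, integral_erf_mul_predHigh, erfCorr_comm v w]
  rotate_left
  · exact i1.add i2
  · exact i3.add i4
  have h1 : ∫ x : Fin k → EuclideanSpace ℝ (Fin d),
      erf (inner ℝ w (x 0)) * erf (inner ℝ v (x 0)) ∂(inputLaw d k) = erfCorr w v := by
    rw [inputLaw, integral_comp_eval (μ := fun _ : Fin k => stdGaussian (EuclideanSpace ℝ (Fin d)))
      (i := 0) (f := fun y => erf (inner ℝ w y) * erf (inner ℝ v y))
      (Measurable.aestronglyMeasurable (by fun_prop))]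
    exact integral_erf_inner_mul_erf_inner w v
  have h2 : ∫ x : Fin k → EuclideanSpace ℝ (Fin d),
      predHigh (fun _ => w) x * predHigh (fun _ => v) x ∂(inputLaw d k) = erfCorr w v ^ k := by
    simp only [predHigh, ← Finset.prod_mul_distrib]
    rw [inputLaw, integral_fintype_prod_eq_prod
      (f := fun _ y => erf (inner ℝ w y) * erf (inner ℝ v y))]
    simp [integral_erf_inner_mul_erf_inner]
  rw [h1, h2, gain, gainCoeff]
  split_ifs <;> ring

lemma objectiveWS_eq {d : ℕ} (k : ℕ) [NeZero k] (u w : EuclideanSpace ℝ (Fin d)) :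
    objectiveWS k u w = 1 / 2 * gain k (erfCorr w w) - gain k (erfCorr w u) +
      1 / 2 * gain k (erfCorr u u) := by
  have h1 : ∀ x : Fin k → EuclideanSpace ℝ (Fin d),
      1 / 2 * (predBothWS w x - predBothWS u x) ^ 2 =
      (1 / 2 * (predBothWS w x * predBothWS w x) - predBothWS w x * predBothWS u x) +
        1 / 2 * (predBothWS u x * predBothWS u x) := fun x => by ring
  unfold objectiveWS
  simp_rw [h1]
  have i1 := integrable_predBothWS_mul (k := k) w w
  have i2 := integrable_predBothWS_mul (k := k) w u
  have i3 := integrable_predBothWS_mul (k := k) u u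
  rw [integral_add ?_ (i3.const_mul _), integral_sub (i1.const_mul _) i2,
    integral_const_mul, integral_const_mul]
  · simp only [integral_predBothWS_mul]
  · exact (i1.const_mul _).sub i2

/-! ### The gradient of the objective -/

/-- The derivative of `gain k`. -/
noncomputable def gainDeriv (k : ℕ) (s : ℝ) : ℝ := gainCoeff k + k * s ^ (k - 1)

lemma hasDerivAt_gain (k : ℕ) (s : ℝ) : HasDerivAt (gain k) (gainDeriv k s) s := by
  refine (((hasDerivAt_id s).const_mul (gainCoeff k)).add (hasDerivAt_pow k s)).congr_deriv ?_
  rw [gainDeriv, mul_one]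

/-- The discriminant `(1 + 2‖w‖²)(1 + 2‖u‖²) - 4⟨w, u⟩²`. -/
noncomputable def corrDisc {d : ℕ} (u w : EuclideanSpace ℝ (Fin d)) : ℝ :=
  (1 + 2 * ‖w‖ ^ 2) * (1 + 2 * ‖u‖ ^ 2) - 4 * inner ℝ w u ^ 2

lemma le_corrDisc {d : ℕ} (u w : EuclideanSpace ℝ (Fin d)) :
    1 + 2 * ‖w‖ ^ 2 + 2 * ‖u‖ ^ 2 ≤ corrDisc u w := by
  have h := real_inner_mul_inner_self_le w u
  rw [real_inner_self_eq_norm_sq, real_inner_self_eq_norm_sq] at h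
  rw [corrDisc]
  nlinarith

lemma corrDisc_pos {d : ℕ} (u w : EuclideanSpace ℝ (Fin d)) : 0 < corrDisc u w :=
  lt_of_lt_of_le (by positivity) (le_corrDisc u w)

lemma hasFDerivAt_norm_sq {d : ℕ} (w : EuclideanSpace ℝ (Fin d)) :
    HasFDerivAt (fun w : EuclideanSpace ℝ (Fin d) => ‖w‖ ^ 2) (2 • innerSL ℝ w) w :=
  (hasStrictFDerivAt_norm_sq w).hasFDerivAt

lemma hasFDerivAt_erfCorr {d : ℕ} (u w : EuclideanSpace ℝ (Fin d)) :
    HasFDerivAt (fun w => erfCorr w u) ((4 / Real.pi / √(corrDisc u w)) •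
      (innerSL ℝ u - (2 * inner ℝ w u / (1 + 2 * ‖w‖ ^ 2)) • innerSL ℝ w)) w := by
  set A := 1 + 2 * ‖w‖ ^ 2 with hA
  set B := 1 + 2 * ‖u‖ ^ 2 with hB
  set p := inner ℝ w u with hp
  have hA0 : 0 < A := by positivity
  have hB0 : 0 < B := by positivity
  have hD := corrDisc_pos u w
  have hDdef : corrDisc u w = A * B - 4 * p ^ 2 := rfl
  set z := 2 * p / √(A * B) with hz
  have hz2 : 1 - z ^ 2 = corrDisc u w / (A * B) := by
    rw [hz, div_pow, Real.sq_sqrt (by positivity), hDdef]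
    field_simp
    ring
  have hz1 : |z| < 1 := by
    rw [← sq_lt_one_iff_abs_lt_one, ← sub_pos, hz2]
    positivity
  have e1 : HasFDerivAt (fun w : EuclideanSpace ℝ (Fin d) => (1 + 2 * ‖w‖ ^ 2) * B)
      (B • (2 : ℝ) • 2 • innerSL ℝ w) w :=
    (((hasFDerivAt_norm_sq w).const_mul 2).const_add 1).mul_const B
  have e2 : HasFDerivAt (fun w : EuclideanSpace ℝ (Fin d) => 2 * inner ℝ w u)
      ((2 : ℝ) • innerSL ℝ u) w := by
    have : HasFDerivAt (fun w : EuclideanSpace ℝ (Fin d) => inner ℝ u w) (innerSL ℝ u) w :=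
      (innerSL ℝ u).hasFDerivAt
    simp_rw [real_inner_comm u] at this ⊢
    exact this.const_mul 2
  have e3 : HasDerivAt (fun t : ℝ => (√t)⁻¹) (-(1 / (2 * √(A * B))) / √(A * B) ^ 2) (A * B) :=
    (Real.hasDerivAt_sqrt (by positivity)).inv (by positivity)
  have e4 := e2.mul (e3.comp_hasFDerivAt w e1)
  have e5 := (((Real.hasDerivAt_arcsin (x := z) (abs_lt.1 hz1).1.ne' (abs_lt.1 hz1).2.ne).const_mul
    (2 / Real.pi))).comp_hasFDerivAt w e4
  refine e5.congr_fderiv ?_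
  ext y
  rw [hz2, Real.sqrt_div hD.le]
  simp only [Function.comp, smul_apply, add_apply,
    sub_apply, innerSL_apply_apply, smul_eq_mul, nsmul_eq_mul, ← hA, ← hp]
  have q1 := Real.sq_sqrt (mul_pos hA0 hB0).le
  have p1 := Real.sqrt_pos.2 (mul_pos hA0 hB0)
  have p2 := Real.sqrt_pos.2 hD
  set s := √(A * B)
  field_simp
  push_cast
  linear_combination 8 * p * inner ℝ w y * q1

/-- On the diagonal the correlation depends on `‖w‖ ^ 2` alone, so the gradient is radial. -/
lemma hasFDerivAt_erfCorr_self {d : ℕ} (w : EuclideanSpace ℝ (Fin d)) :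
    HasFDerivAt (fun w => erfCorr w w)
      ((8 / Real.pi / ((1 + 2 * ‖w‖ ^ 2) * √(1 + 4 * ‖w‖ ^ 2))) • innerSL ℝ w) w := by
  have h1 : (fun w : EuclideanSpace ℝ (Fin d) => erfCorr w w) =
      fun w => 2 / Real.pi * Real.arcsin (2 * ‖w‖ ^ 2 / (1 + 2 * ‖w‖ ^ 2)) := by
    funext w
    rw [erfCorr, Real.sqrt_mul_self (by positivity), real_inner_self_eq_norm_sq]
  rw [h1]
  set q := ‖w‖ ^ 2 with hq
  have hq0 : 0 ≤ q := by positivity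
  have hA0 : 0 < 1 + 2 * q := by positivity
  set z := 2 * q / (1 + 2 * q) with hz
  have hz2 : 1 - z ^ 2 = (1 + 4 * q) / (1 + 2 * q) ^ 2 := by
    rw [hz, div_pow]
    field_simp
    ring
  have hz1 : |z| < 1 := by
    rw [← sq_lt_one_iff_abs_lt_one, ← sub_pos, hz2]
    positivity
  have e1 : HasDerivAt (fun t : ℝ => 2 * t / (1 + 2 * t))
      ((2 * 1 * (1 + 2 * q) - 2 * q * (2 * 1)) / (1 + 2 * q) ^ 2) q :=
    ((hasDerivAt_id q).const_mul 2).div (((hasDerivAt_id q).const_mul 2).const_add 1) hA0.ne'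
  have e2 := (((Real.hasDerivAt_arcsin (x := z) (abs_lt.1 hz1).1.ne'
    (abs_lt.1 hz1).2.ne).const_mul (2 / Real.pi)).comp q e1).comp_hasFDerivAt w
      (hasFDerivAt_norm_sq w)
  refine e2.congr_fderiv ?_
  ext y
  rw [hz2, Real.sqrt_div (by positivity), Real.sqrt_sq hA0.le]
  simp only [smul_apply, innerSL_apply_apply, smul_eq_mul, nsmul_eq_mul]
  have p2 : 0 < √(1 + 4 * q) := Real.sqrt_pos.2 (by positivity)
  field_simp
  push_cast
  ring

/-- The coefficient of `u` in the negative gradient of the objective at `w`. -/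
noncomputable def attraction {d : ℕ} (k : ℕ) (u w : EuclideanSpace ℝ (Fin d)) : ℝ :=
  4 / Real.pi * (gainDeriv k (erfCorr w u) / √(corrDisc u w))

/-- The coefficient of `w` in the gradient of the objective at `w`. -/
noncomputable def contraction {d : ℕ} (k : ℕ) (u w : EuclideanSpace ℝ (Fin d)) : ℝ :=
  4 / Real.pi * (gainDeriv k (erfCorr w w) / ((1 + 2 * ‖w‖ ^ 2) * √(1 + 4 * ‖w‖ ^ 2)) +
    gainDeriv k (erfCorr w u) / √(corrDisc u w) * (2 * inner ℝ w u / (1 + 2 * ‖w‖ ^ 2)))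

lemma gradient_objectiveWS {d : ℕ} (k : ℕ) [NeZero k] (u w : EuclideanSpace ℝ (Fin d)) :
    gradient (objectiveWS k u) w = contraction k u w • w - attraction k u w • u := by
  apply HasGradientAt.gradient
  rw [hasGradientAt_iff_hasFDerivAt]
  have h1 : objectiveWS k u = fun w => 1 / 2 * gain k (erfCorr w w) - gain k (erfCorr w u) +
      1 / 2 * gain k (erfCorr u u) := funext (objectiveWS_eq k u)
  rw [h1]
  have e := ((((hasDerivAt_gain k _).comp_hasFDerivAt w (hasFDerivAt_erfCorr_self w)).const_mul
    (1 / 2)).sub ((hasDerivAt_gain k _).comp_hasFDerivAt w (hasFDerivAt_erfCorr u w))).add_const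
      (1 / 2 * gain k (erfCorr u u))
  refine e.congr_fderiv ?_
  ext y
  simp only [smul_apply, sub_apply,
    innerSL_apply_apply, smul_eq_mul, InnerProductSpace.toDual_apply_apply, inner_sub_left,
    real_inner_smul_left, contraction, attraction]
  ring

/-! ### Bounds on the coefficients of the gradient -/

lemma one_le_gainCoeff (k : ℕ) : 1 ≤ gainCoeff k := by
  unfold gainCoeff
  split_ifs <;> norm_num

lemma gainCoeff_le_three (k : ℕ) : gainCoeff k ≤ 3 := by
  unfold gainCoeff
  split_ifs <;> norm_num

lemma gainDeriv_mono (k : ℕ) {s t : ℝ} (hs : 0 ≤ s) (hst : s ≤ t) :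
    gainDeriv k s ≤ gainDeriv k t := by
  unfold gainDeriv
  gcongr

lemma one_le_gainDeriv (k : ℕ) {s : ℝ} (hs : 0 ≤ s) : 1 ≤ gainDeriv k s := by
  have h1 := one_le_gainCoeff k
  have h2 : (0 : ℝ) ≤ k * s ^ (k - 1) := by positivity
  unfold gainDeriv
  linarith

lemma gainDeriv_le (k : ℕ) {s : ℝ} (hs : 0 ≤ s) (hs1 : s ≤ 1) : gainDeriv k s ≤ k + 3 := by
  have h1 := gainCoeff_le_three k
  have h2 : (k : ℝ) * s ^ (k - 1) ≤ k * 1 := by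
    gcongr
    exact pow_le_one₀ hs hs1
  unfold gainDeriv
  linarith

lemma erfCorr_nonneg {d : ℕ} {w v : EuclideanSpace ℝ (Fin d)} (h : 0 ≤ inner ℝ w v) :
    0 ≤ erfCorr w v :=
  mul_nonneg (by positivity) (Real.arcsin_nonneg.2 (by positivity))

lemma erfCorr_le_one {d : ℕ} (w v : EuclideanSpace ℝ (Fin d)) : erfCorr w v ≤ 1 := by
  have h := Real.arcsin_le_pi_div_two
    (2 * inner ℝ w v / √((1 + 2 * ‖w‖ ^ 2) * (1 + 2 * ‖v‖ ^ 2)))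
  calc erfCorr w v ≤ 2 / Real.pi * (Real.pi / 2) := by
        unfold erfCorr
        gcongr
    _ = 1 := by field_simp

lemma erfCorr_self_nonneg {d : ℕ} (w : EuclideanSpace ℝ (Fin d)) : 0 ≤ erfCorr w w :=
  erfCorr_nonneg real_inner_self_nonneg

lemma contraction_nonneg {d : ℕ} (k : ℕ) {u w : EuclideanSpace ℝ (Fin d)}
    (h : 0 ≤ inner ℝ w u) : 0 ≤ contraction k u w := by
  have h1 := one_le_gainDeriv k (erfCorr_self_nonneg w)
  have h2 := one_le_gainDeriv k (erfCorr_nonneg h)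
  have h3 := corrDisc_pos u w
  unfold contraction
  positivity

lemma four_div_pi_le_two : 4 / Real.pi ≤ 2 := by
  rw [div_le_iff₀ Real.pi_pos]
  linarith [Real.pi_gt_three]

lemma one_le_four_div_pi : 1 ≤ 4 / Real.pi := by
  rw [le_div_iff₀ Real.pi_pos]
  linarith [Real.pi_le_four]

lemma contraction_le {d : ℕ} (k : ℕ) {u w : EuclideanSpace ℝ (Fin d)}
    (h : 0 ≤ inner ℝ w u) : contraction k u w ≤ 4 * (k + 3) := by
  have h1 := one_le_gainDeriv k (erfCorr_self_nonneg w)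
  have h2 := one_le_gainDeriv k (erfCorr_nonneg h)
  have h1' := gainDeriv_le k (erfCorr_self_nonneg w) (erfCorr_le_one w w)
  have h2' := gainDeriv_le k (erfCorr_nonneg h) (erfCorr_le_one w u)
  have hD := corrDisc_pos u w
  have hA : 0 < 1 + 2 * ‖w‖ ^ 2 := by positivity
  have hs : ‖u‖ ≤ √(corrDisc u w) := by
    apply Real.le_sqrt_of_sq_le
    nlinarith [le_corrDisc u w, sq_nonneg ‖w‖, sq_nonneg ‖u‖]
  have e1 : gainDeriv k (erfCorr w w) / ((1 + 2 * ‖w‖ ^ 2) * √(1 + 4 * ‖w‖ ^ 2)) ≤ k + 3 := by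
    refine (div_le_self (by linarith) ?_).trans h1'
    have : 1 ≤ √(1 + 4 * ‖w‖ ^ 2) := Real.one_le_sqrt.2 (by nlinarith [sq_nonneg ‖w‖])
    nlinarith [sq_nonneg ‖w‖]
  have e2 : gainDeriv k (erfCorr w u) / √(corrDisc u w) *
      (2 * inner ℝ w u / (1 + 2 * ‖w‖ ^ 2)) ≤ k + 3 := by
    have hp : 2 * inner ℝ w u ≤ √(corrDisc u w) * (1 + 2 * ‖w‖ ^ 2) := by
      have c := real_inner_le_norm w u
      calc 2 * inner ℝ w u ≤ ‖u‖ * (2 * ‖w‖) := by linarith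
        _ ≤ √(corrDisc u w) * (1 + 2 * ‖w‖ ^ 2) := by
          gcongr
          nlinarith [sq_nonneg (‖w‖ - 1), sq_nonneg ‖w‖]
    rw [div_mul_div_comm, mul_div_assoc]
    refine (mul_le_of_le_one_right (by linarith) ?_).trans h2'
    rwa [div_le_one (by positivity)]
  have e0 : 0 ≤ gainDeriv k (erfCorr w w) / ((1 + 2 * ‖w‖ ^ 2) * √(1 + 4 * ‖w‖ ^ 2)) +
    gainDeriv k (erfCorr w u) / √(corrDisc u w) * (2 * inner ℝ w u / (1 + 2 * ‖w‖ ^ 2)) := by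
    positivity
  unfold contraction
  nlinarith [four_div_pi_le_two]

/-- Times `η`, this lower bound is the rate at which the tangent of the angle shrinks. -/
lemma le_attraction {d : ℕ} (k : ℕ) {u w : EuclideanSpace ℝ (Fin d)}
    (h : 0 ≤ inner ℝ w u) (hwu : ‖w‖ ≤ ‖u‖) : 1 / (1 + 2 * ‖u‖ ^ 2) ≤ attraction k u w := by
  have h2 := one_le_gainDeriv k (erfCorr_nonneg h)
  have hD := corrDisc_pos u w
  have hs : √(corrDisc u w) ≤ 1 + 2 * ‖u‖ ^ 2 := by
    rw [Real.sqrt_le_left (by positivity), corrDisc]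
    have h1 : (1 + 2 * ‖w‖ ^ 2) * (1 + 2 * ‖u‖ ^ 2) ≤ (1 + 2 * ‖u‖ ^ 2) * (1 + 2 * ‖u‖ ^ 2) := by
      gcongr
    nlinarith [sq_nonneg (inner ℝ w u)]
  unfold attraction
  calc 1 / (1 + 2 * ‖u‖ ^ 2) ≤ gainDeriv k (erfCorr w u) / √(corrDisc u w) := by gcongr
    _ ≤ _ := le_mul_of_one_le_left (by positivity) one_le_four_div_pi

/-! ### Elementary inequalities for the radial drift -/

/-- Rationalise: the numerator `r² √E - p √D` times its conjugate is `r⁴ E - p² D`, and the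
conjugate is at most `2 r² M`. -/
lemma le_div_sqrt_sub_div_sqrt {r p D E M δ : ℝ} (hr : 0 < r) (hp : 0 < p) (hpr : p ≤ r ^ 2)
    (hD : 0 < D) (hE : 0 < E) (hM : 0 < M) (hDM : √D ≤ M) (hEM : √E ≤ M) (hδ : 0 ≤ δ)
    (h : r ^ 3 * δ / 2 ≤ r ^ 4 * E - p ^ 2 * D) :
    r * δ / (4 * M ^ 3) ≤ r ^ 2 / √D - p / √E := by
  have hx := Real.sqrt_pos.2 hD
  have hy := Real.sqrt_pos.2 hE
  rw [← Real.sq_sqrt hE.le, ← Real.sq_sqrt hD.le] at h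
  set x := √D
  set y := √E
  have e2 : r ^ 2 * y + p * x ≤ 2 * r ^ 2 * M := by
    calc r ^ 2 * y + p * x ≤ r ^ 2 * M + r ^ 2 * M := by gcongr
      _ = _ := by ring
  have e3 : 0 < r ^ 2 * y + p * x := by positivity
  have e4 : r * δ / (4 * M) ≤ r ^ 2 * y - p * x := by
    refine le_of_mul_le_mul_right ?_ e3
    calc r * δ / (4 * M) * (r ^ 2 * y + p * x) ≤ r * δ / (4 * M) * (2 * r ^ 2 * M) := by gcongr
      _ = r ^ 3 * δ / 2 := by
        field_simp
        norm_num
      _ ≤ r ^ 4 * y ^ 2 - p ^ 2 * x ^ 2 := h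
      _ = _ := by ring
  have e5 : 0 ≤ r * δ / (4 * M) := by positivity
  calc r * δ / (4 * M ^ 3) = r * δ / (4 * M) / (M * M) := by field_simp
    _ ≤ (r ^ 2 * y - p * x) / (x * y) := by
      gcongr
      exact e5.trans e4
    _ = _ := by field_simp

/-- With `G = a² r² - p²`, the right side equals `(1 + 2a²)(r⁴ - p²) + 2r² G - 4p² G`. A small angle
makes `G` small, so the only negative term is absorbed by `2a² (r⁴ - p²)`. -/
lemma gap_le_disc_gap {r a p τ ε : ℝ} (hε : 0 ≤ ε) (hr1 : 1 ≤ r) (hp0 : 0 < p)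
    (hpr : p ≤ r ^ 2) (hcs : p ^ 2 ≤ a ^ 2 * r ^ 2)
    (hG : a ^ 2 * r ^ 2 - p ^ 2 ≤ τ ^ 2 * p ^ 2) (hτ : 14 * r ^ 3 * τ ^ 2 ≤ ε)
    (hp : p ≤ r ^ 2 - r * ε / 2) :
    r ^ 3 * ε / 2 ≤ r ^ 4 * (1 + 4 * a ^ 2) -
      p ^ 2 * ((1 + 2 * a ^ 2) * (1 + 2 * r ^ 2) - 4 * p ^ 2) := by
  have hgap : r ^ 3 * ε / 2 ≤ r ^ 4 - p ^ 2 := by nlinarith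
  have e1 : 4 * p ^ 2 * (a ^ 2 * r ^ 2 - p ^ 2) ≤ p ^ 2 * (r * ε) := by
    have e2 : τ ^ 2 * p ^ 2 ≤ τ ^ 2 * r ^ 4 := by
      calc τ ^ 2 * p ^ 2 ≤ τ ^ 2 * (r ^ 2) ^ 2 := by gcongr
        _ = _ := by ring
    have e3 : r * (14 * r ^ 3 * τ ^ 2) ≤ r * ε := by gcongr
    have e4 : 4 * (a ^ 2 * r ^ 2 - p ^ 2) ≤ r * ε := by
      have : 0 ≤ τ ^ 2 * r ^ 4 := by positivity
      linarith
    calc 4 * p ^ 2 * (a ^ 2 * r ^ 2 - p ^ 2) = p ^ 2 * (4 * (a ^ 2 * r ^ 2 - p ^ 2)) := by ring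
      _ ≤ _ := by gcongr
  have e5 : p ^ 2 * (r * ε) ≤ 2 * a ^ 2 * (r ^ 4 - p ^ 2) := by
    calc p ^ 2 * (r * ε) ≤ a ^ 2 * r ^ 2 * (r * ε) := by gcongr
      _ = 2 * a ^ 2 * (r ^ 3 * ε / 2) := by ring
      _ ≤ _ := by gcongr
  have e7 : 0 ≤ 2 * r ^ 2 * (a ^ 2 * r ^ 2 - p ^ 2) := mul_nonneg (by positivity) (by linarith)
  linarith

/-- Here `g₁`, `g₂` stand for the derivative of `gain` at the self-correlation of `w` and at its
correlation with `u`. Since `g₁ ≤ g₂`, the drift is bounded below by a multiple of `r² / √D - p /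
√(1 + 4a²)`. -/
lemma drift_le {r a p ε D g₁ g₂ : ℝ} (hε : 0 < ε) (hr1 : 1 ≤ r) (ha0 : 0 ≤ a) (hp0 : 0 < p)
    (hpr : p ≤ r ^ 2) (har : a ≤ r) (hcs : p ^ 2 ≤ a ^ 2 * r ^ 2) (hD0 : 0 < D)
    (hD : D = (1 + 2 * a ^ 2) * (1 + 2 * r ^ 2) - 4 * p ^ 2)
    (hmain : r ^ 3 * ε / 2 ≤ r ^ 4 * (1 + 4 * a ^ 2) - p ^ 2 * D)
    (hg₁ : 1 ≤ g₁) (hg : g₁ ≤ g₂) :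
    r * ε / (4 * (1 + 4 * r ^ 2) ^ 4) ≤ 4 / Real.pi * (g₂ / √D) * r ^ 2 -
      4 / Real.pi * (g₁ / ((1 + 2 * a ^ 2) * √(1 + 4 * a ^ 2)) +
        g₂ / √D * (2 * p / (1 + 2 * a ^ 2))) * p := by
  have hr0 : 0 < r := by linarith
  have hA0 : 0 < 1 + 2 * a ^ 2 := by positivity
  have hE0 : 0 < 1 + 4 * a ^ 2 := by positivity
  have har2 : a ^ 2 ≤ r ^ 2 := by gcongr
  have hM1 : 1 ≤ 1 + 4 * r ^ 2 := by linarith [sq_nonneg r]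
  have haM : 1 + 2 * a ^ 2 ≤ 1 + 4 * r ^ 2 := by linarith [sq_nonneg r]
  have hEM : 1 + 4 * a ^ 2 ≤ 1 + 4 * r ^ 2 := by linarith
  have hDM : D ≤ (1 + 4 * r ^ 2) ^ 2 := by
    have : (1 + 2 * a ^ 2) * (1 + 2 * r ^ 2) ≤ (1 + 4 * r ^ 2) * (1 + 4 * r ^ 2) := by
      gcongr
      norm_num
    linarith [sq_nonneg p]
  generalize 1 + 4 * r ^ 2 = M at *
  have sD := Real.sqrt_pos.2 hD0
  have sE := Real.sqrt_pos.2 hE0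
  have sDM : √D ≤ M := (Real.sqrt_le_left (by linarith)).2 hDM
  have sEM : √(1 + 4 * a ^ 2) ≤ M := (Real.sqrt_le_left (by linarith)).2 (by nlinarith)
  have hM0 : 0 < M := by linarith
  have hdiff := le_div_sqrt_sub_div_sqrt hr0 hp0 hpr hD0 hE0 hM0 sDM sEM hε.le hmain
  generalize √D = x at *
  generalize √(1 + 4 * a ^ 2) = y at *
  have hfac : 4 / Real.pi * (g₂ / x) * r ^ 2 -
      4 / Real.pi * (g₁ / ((1 + 2 * a ^ 2) * y) + g₂ / x * (2 * p / (1 + 2 * a ^ 2))) * p =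
      4 / Real.pi * ((g₂ * ((r ^ 2 + 2 * (a ^ 2 * r ^ 2 - p ^ 2)) / x) - g₁ * (p / y)) /
        (1 + 2 * a ^ 2)) := by
    field_simp
    ring
  rw [hfac]
  have hb0 : 0 ≤ r * ε / (4 * M ^ 3) := by positivity
  have hin : r * ε / (4 * M ^ 3) ≤
      g₂ * ((r ^ 2 + 2 * (a ^ 2 * r ^ 2 - p ^ 2)) / x) - g₁ * (p / y) := by
    have f1 : r ^ 2 / x ≤ (r ^ 2 + 2 * (a ^ 2 * r ^ 2 - p ^ 2)) / x := by
      gcongr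
      linarith
    have f0 : 0 ≤ r ^ 2 / x := by positivity
    have f2 : g₁ * (r ^ 2 / x) ≤ g₂ * ((r ^ 2 + 2 * (a ^ 2 * r ^ 2 - p ^ 2)) / x) :=
      mul_le_mul hg f1 f0 (by linarith)
    have f3 : r ^ 2 / x - p / y ≤ g₁ * (r ^ 2 / x - p / y) :=
      le_mul_of_one_le_left (hb0.trans hdiff) hg₁
    linarith
  calc r * ε / (4 * M ^ 4) = r * ε / (4 * M ^ 3) / M := by field_simp
    _ ≤ (g₂ * ((r ^ 2 + 2 * (a ^ 2 * r ^ 2 - p ^ 2)) / x) - g₁ * (p / y)) /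
        (1 + 2 * a ^ 2) := div_le_div₀ (hb0.trans hin) hin hA0 haM
    _ ≤ _ := le_mul_of_one_le_left (div_nonneg (hb0.trans hin) hA0.le) one_le_four_div_pi

/-! ### One step of projected gradient descent -/

/-- Positivity of `c` preserves angles; the final alternative separates free steps from those ending
on the sphere. -/
lemma projBall_eq_smul {d : ℕ} {r : ℝ} (hr : 0 < r) (v : EuclideanSpace ℝ (Fin d)) :
    ∃ c : ℝ, 0 < c ∧ projBall r v = c • v ∧ ‖projBall r v‖ ≤ r ∧
      (c = 1 ∨ ‖projBall r v‖ = r) := by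
  unfold projBall
  split_ifs with h
  · exact ⟨1, one_pos, (one_smul _ _).symm, h, Or.inl rfl⟩
  · have hv : 0 < ‖v‖ := hr.trans (not_le.1 h)
    have hn : ‖(r / ‖v‖) • v‖ = r := by
      rw [norm_smul, Real.norm_of_nonneg (by positivity)]
      field_simp
    exact ⟨r / ‖v‖, by positivity, rfl, hn.le, Or.inr hn⟩

lemma gdStep_eq {d : ℕ} (k : ℕ) [NeZero k] (η : ℝ) (u w : EuclideanSpace ℝ (Fin d)) :
    gdStep k η u w = projBall ‖u‖
      ((1 - η * contraction k u w) • w + (η * attraction k u w) • u) := by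
  rw [gdStep, gradient_objectiveWS]
  congr 1
  module

/-- `w` lies in the ball of radius `‖u‖` and forms with `u` an acute angle of tangent at most
`τ`. -/
structure Aligned {d : ℕ} (u w : EuclideanSpace ℝ (Fin d)) (τ : ℝ) : Prop where
  norm_le : ‖w‖ ≤ ‖u‖
  inner_pos : 0 < inner ℝ w u
  gram_le : ‖w‖ ^ 2 * ‖u‖ ^ 2 - inner ℝ w u ^ 2 ≤ τ ^ 2 * inner ℝ w u ^ 2

namespace Aligned

variable {d : ℕ} {u w : EuclideanSpace ℝ (Fin d)} {τ τ' : ℝ}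

lemma mono (h : Aligned u w τ) (hτ : 0 ≤ τ) (hττ' : τ ≤ τ') : Aligned u w τ' where
  norm_le := h.norm_le
  inner_pos := h.inner_pos
  gram_le := h.gram_le.trans (by gcongr)

lemma norm_target_pos (h : Aligned u w τ) : 0 < ‖u‖ := by
  have h1 := h.inner_pos
  refine norm_pos_iff.2 fun hu => ?_
  rw [hu, inner_zero_right] at h1
  exact lt_irrefl _ h1

lemma inner_le (h : Aligned u w τ) : inner ℝ w u ≤ ‖u‖ ^ 2 := by
  have h1 := real_inner_le_norm w u
  nlinarith [h.norm_le, norm_nonneg u]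

/-- Adding a multiple of `u` does not change the Gram determinant with `u`, which is only scaled by
`(c * a) ^ 2`, whereas the inner product gains an extra factor of at least `1 + y`. -/
lemma gdStep (h : Aligned u w τ) {k : ℕ} [NeZero k] {η y : ℝ} (hη : 0 ≤ η)
    (hX : η * contraction k u w < 1) (hy : 0 ≤ y) (hY : y ≤ η * attraction k u w) :
    Aligned u (gdStep k η u w) (τ / (1 + y)) := by
  have hu := h.norm_target_pos
  obtain ⟨c, hc, hproj, hle, -⟩ := projBall_eq_smul hu
    ((1 - η * contraction k u w) • w + (η * attraction k u w) • u)
  have hX0 : 0 ≤ η * contraction k u w := mul_nonneg hη (contraction_nonneg k h.inner_pos.le)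
  rw [gdStep_eq]
  set a := 1 - η * contraction k u w with ha
  set b := η * attraction k u w
  have ha0 : 0 < a := by linarith
  have ha1 : a ≤ 1 := by linarith
  set p := inner ℝ w u with hp
  have hp0 : 0 < p := h.inner_pos
  have hinner : inner ℝ (projBall ‖u‖ (a • w + b • u)) u = c * (a * p + b * ‖u‖ ^ 2) := by
    rw [hproj, real_inner_smul_left, inner_add_left, real_inner_smul_left, real_inner_smul_left,
      real_inner_self_eq_norm_sq]
  have hnorm : ‖projBall ‖u‖ (a • w + b • u)‖ ^ 2 =
      c ^ 2 * (a ^ 2 * ‖w‖ ^ 2 + 2 * (a * b * p) + b ^ 2 * ‖u‖ ^ 2) := by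
    rw [hproj, norm_smul, mul_pow, norm_add_sq_real, norm_smul, norm_smul, real_inner_smul_left,
      real_inner_smul_right]
    simp only [mul_pow, Real.norm_eq_abs, sq_abs]
    ring
  have hlow : a * p * (1 + y) ≤ a * p + b * ‖u‖ ^ 2 := by
    have h1 : a * p ≤ ‖u‖ ^ 2 := (mul_le_of_le_one_left hp0.le ha1).trans h.inner_le
    have h2 : a * p * y ≤ ‖u‖ ^ 2 * b := by gcongr
    linarith
  refine ⟨hle, ?_, ?_⟩
  · rw [hinner]
    have : 0 < a * p * (1 + y) := by positivity
    exact mul_pos hc (by linarith)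
  · rw [hinner, hnorm]
    have h1 : c ^ 2 * (a ^ 2 * ‖w‖ ^ 2 + 2 * (a * b * p) + b ^ 2 * ‖u‖ ^ 2) * ‖u‖ ^ 2 -
        (c * (a * p + b * ‖u‖ ^ 2)) ^ 2 = (c * a) ^ 2 * (‖w‖ ^ 2 * ‖u‖ ^ 2 - p ^ 2) := by ring
    rw [h1]
    calc (c * a) ^ 2 * (‖w‖ ^ 2 * ‖u‖ ^ 2 - p ^ 2) ≤ (c * a) ^ 2 * (τ ^ 2 * p ^ 2) := by
          have := h.gram_le
          gcongr
      _ = (τ / (1 + y)) ^ 2 * (c * (a * p * (1 + y))) ^ 2 := by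
          field_simp
      _ ≤ _ := by gcongr

/-- Pythagoras: `r² ‖w - u‖² = (r² ‖w‖² - p²) + (r² - p)²`, and each summand is at most `r² ε² / 4`.
-/
lemma norm_sub_le (h : Aligned u w τ) {ε : ℝ} (hε : 0 ≤ ε) (hτ0 : 0 ≤ τ)
    (hτ : 2 * ‖u‖ * τ ≤ ε)
    (hp : ‖u‖ ^ 2 - ‖u‖ * ε / 2 ≤ inner ℝ w u) : ‖w - u‖ ≤ ε := by
  have hu := h.norm_target_pos
  refine abs_le_of_sq_le_sq' ?_ hε |>.2
  have h1 := h.gram_le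
  have h2 := h.inner_le
  have h3 := h.inner_pos
  rw [norm_sub_sq_real]
  set p := inner ℝ w u
  set r := ‖u‖
  have e1 : τ ^ 2 * p ^ 2 ≤ r ^ 2 * ε ^ 2 / 4 := by
    have : τ * p ≤ ε * r / 2 := by
      calc τ * p ≤ τ * r ^ 2 := by gcongr
        _ = (2 * r * τ) * r / 2 := by ring
        _ ≤ ε * r / 2 := by gcongr
    calc τ ^ 2 * p ^ 2 = (τ * p) ^ 2 := by ring
      _ ≤ (ε * r / 2) ^ 2 := by gcongr
      _ = _ := by ring
  have e2 : (r ^ 2 - p) ^ 2 ≤ (r * ε / 2) ^ 2 := by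
    have : 0 ≤ r ^ 2 - p := by linarith
    gcongr
    linarith
  have e3 : r ^ 2 * (‖w‖ ^ 2 - 2 * p + r ^ 2) ≤ r ^ 2 * ε ^ 2 := by nlinarith [sq_nonneg (r * ε)]
  exact le_of_mul_le_mul_left e3 (by positivity)

lemma erfCorr_self_le (h : Aligned u w τ) {ε : ℝ} (hτ0 : 0 ≤ τ) (hτ1 : τ ≤ 1)
    (hu1 : 1 ≤ ‖u‖) (hτ : 14 * ‖u‖ ^ 3 * τ ^ 2 ≤ ε)
    (hp : inner ℝ w u ≤ ‖u‖ ^ 2 - ‖u‖ * ε / 2) : erfCorr w w ≤ erfCorr w u := by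
  have hG := h.gram_le
  have hp0 := h.inner_pos
  have hpr := h.inner_le
  rw [erfCorr, erfCorr, Real.sqrt_mul_self (by positivity), real_inner_self_eq_norm_sq]
  set p := inner ℝ w u
  set r := ‖u‖
  set a := ‖w‖
  have hA : 0 < 1 + 2 * a ^ 2 := by positivity
  have ha : r ^ 2 * a ^ 2 ≤ (1 + τ ^ 2) * p ^ 2 := by linarith
  have hτ2 : τ ^ 2 ≤ 1 := pow_le_one₀ hτ0 hτ1
  -- The `14` in the hypothesis is twice the `7` needed in `g1` below.
  have hgap : 7 * r ^ 6 * τ ^ 2 ≤ r ^ 4 - p ^ 2 := by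
    have e1 : r ^ 2 * (r * ε / 2) ≤ r ^ 4 - p ^ 2 := by nlinarith
    have e2 : r ^ 3 * (14 * r ^ 3 * τ ^ 2) ≤ r ^ 3 * ε := by gcongr
    nlinarith
  have hp2 : p ^ 2 ≤ r ^ 4 := by
    calc p ^ 2 ≤ (r ^ 2) ^ 2 := by gcongr
      _ = r ^ 4 := by ring
  have hr2 : 1 ≤ r ^ 2 := one_le_pow₀ hu1
  -- This is the comparison of the squared arcsine arguments. It reads `a⁴ + 2a² (a² r² - p²) ≤ p²`,
  -- and is checked after multiplying by `r⁴`.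
  have key : a ^ 4 * (1 + 2 * r ^ 2) ≤ p ^ 2 * (1 + 2 * a ^ 2) := by
    have f1 : r ^ 4 * a ^ 4 ≤ ((1 + τ ^ 2) * p ^ 2) ^ 2 := by
      calc r ^ 4 * a ^ 4 = (r ^ 2 * a ^ 2) ^ 2 := by ring
        _ ≤ _ := by gcongr
    have f2 : r ^ 2 * a ^ 2 * (a ^ 2 * r ^ 2 - p ^ 2) ≤ (1 + τ ^ 2) * p ^ 2 * (τ ^ 2 * p ^ 2) := by
      have hg0 : 0 ≤ τ ^ 2 * p ^ 2 := by positivity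
      calc r ^ 2 * a ^ 2 * (a ^ 2 * r ^ 2 - p ^ 2) ≤ r ^ 2 * a ^ 2 * (τ ^ 2 * p ^ 2) := by gcongr
        _ ≤ _ := by gcongr
    have f3 : ((1 + τ ^ 2) * p ^ 2) ^ 2 + 2 * r ^ 2 * ((1 + τ ^ 2) * p ^ 2 * (τ ^ 2 * p ^ 2)) ≤
        r ^ 4 * p ^ 2 := by
      have g1 : (1 + τ ^ 2) ^ 2 + 2 * r ^ 2 * (1 + τ ^ 2) * τ ^ 2 ≤ 1 + 7 * r ^ 2 * τ ^ 2 := by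
        have g2 : (1 + τ ^ 2) ^ 2 ≤ 1 + 3 * (r ^ 2 * τ ^ 2) := by nlinarith [sq_nonneg τ]
        have g3 : 2 * r ^ 2 * (1 + τ ^ 2) * τ ^ 2 ≤ 2 * r ^ 2 * (1 + 1) * τ ^ 2 := by gcongr
        linarith
      have g4 : (1 + 7 * r ^ 2 * τ ^ 2) * p ^ 2 ≤ r ^ 4 := by
        have : 7 * r ^ 2 * τ ^ 2 * p ^ 2 ≤ 7 * r ^ 2 * τ ^ 2 * r ^ 4 := by gcongr
        nlinarith
      calc ((1 + τ ^ 2) * p ^ 2) ^ 2 + 2 * r ^ 2 * ((1 + τ ^ 2) * p ^ 2 * (τ ^ 2 * p ^ 2))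
          = ((1 + τ ^ 2) ^ 2 + 2 * r ^ 2 * (1 + τ ^ 2) * τ ^ 2) * p ^ 2 * p ^ 2 := by ring
        _ ≤ (1 + 7 * r ^ 2 * τ ^ 2) * p ^ 2 * p ^ 2 := by gcongr
        _ ≤ r ^ 4 * p ^ 2 := by gcongr
    have f4 : 0 ≤ r ^ 4 * (p ^ 2 * (1 + 2 * a ^ 2) - a ^ 4 * (1 + 2 * r ^ 2)) := by nlinarith
    have f5 : 0 < r ^ 4 := by positivity
    linarith [nonneg_of_mul_nonneg_right f4 f5]
  have hB : 0 < 1 + 2 * r ^ 2 := by positivity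
  have hz : 2 * a ^ 2 / (1 + 2 * a ^ 2) ≤ 2 * p / √((1 + 2 * a ^ 2) * (1 + 2 * r ^ 2)) := by
    rw [div_le_div_iff₀ hA (by positivity)]
    have : a ^ 2 * √((1 + 2 * a ^ 2) * (1 + 2 * r ^ 2)) ≤ p * (1 + 2 * a ^ 2) := by
      refine abs_le_of_sq_le_sq' ?_ (by positivity) |>.2
      rw [mul_pow, Real.sq_sqrt (by positivity)]
      nlinarith
    linarith
  have := Real.monotone_arcsin hz
  gcongr

lemma le_drift (h : Aligned u w τ) {ε : ℝ} (hε : 0 < ε) (hτ0 : 0 ≤ τ) (hτ1 : τ ≤ 1)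
    (hu1 : 1 ≤ ‖u‖) (hτ : 14 * ‖u‖ ^ 3 * τ ^ 2 ≤ ε)
    (hp : inner ℝ w u ≤ ‖u‖ ^ 2 - ‖u‖ * ε / 2) (k : ℕ) :
    ‖u‖ * ε / (4 * (1 + 4 * ‖u‖ ^ 2) ^ 4) ≤
      attraction k u w * ‖u‖ ^ 2 - contraction k u w * inner ℝ w u := by
  have hcs : inner ℝ w u ^ 2 ≤ ‖w‖ ^ 2 * ‖u‖ ^ 2 := by
    have := real_inner_mul_inner_self_le w u
    rw [real_inner_self_eq_norm_sq, real_inner_self_eq_norm_sq] at this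
    nlinarith
  have hD0 := corrDisc_pos u w
  have hD : corrDisc u w = (1 + 2 * ‖w‖ ^ 2) * (1 + 2 * ‖u‖ ^ 2) - 4 * inner ℝ w u ^ 2 := rfl
  have hmain := gap_le_disc_gap hε.le hu1 h.inner_pos h.inner_le hcs h.gram_le hτ hp
  rw [← hD] at hmain
  exact drift_le hε hu1 (norm_nonneg w) h.inner_pos h.inner_le h.norm_le hcs hD0 hD hmain
    (one_le_gainDeriv k (erfCorr_self_nonneg w))
    (gainDeriv_mono k (erfCorr_self_nonneg w) (h.erfCorr_self_le hτ0 hτ1 hu1 hτ hp))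

end Aligned

namespace Aligned

variable {d : ℕ} {u w : EuclideanSpace ℝ (Fin d)} {τ : ℝ}

/-- Zero vectors are excluded because their angle is `π / 2`, which no arctangent reaches. -/
lemma of_angle_lt (hwu : ‖w‖ ≤ ‖u‖)
    (h : InnerProductGeometry.angle u w < Real.arctan τ) : Aligned u w τ := by
  set θ := InnerProductGeometry.angle u w with hθ
  have hθ0 : 0 ≤ θ := InnerProductGeometry.angle_nonneg u w
  have hθ1 : θ < Real.pi / 2 := h.trans (Real.arctan_lt_pi_div_two τ)
  have hu : u ≠ 0 := by
    rintro rfl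
    rw [hθ, InnerProductGeometry.angle_zero_left] at hθ1
    exact lt_irrefl _ hθ1
  have hw : w ≠ 0 := by
    rintro rfl
    rw [hθ, InnerProductGeometry.angle_zero_right] at hθ1
    exact lt_irrefl _ hθ1
  have hcos : 0 < Real.cos θ := Real.cos_pos_of_mem_Ioo ⟨by linarith [Real.pi_pos], hθ1⟩
  have htan : Real.tan θ < τ := by
    rwa [← Real.arctan_strictMono.lt_iff_lt, Real.arctan_tan (by linarith [Real.pi_pos]) hθ1]
  have htan0 : 0 ≤ Real.tan θ := Real.tan_nonneg_of_nonneg_of_le_pi_div_two hθ0 hθ1.le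
  have hinner : inner ℝ w u = Real.cos θ * (‖u‖ * ‖w‖) := by
    rw [real_inner_comm, hθ, InnerProductGeometry.cos_angle_mul_norm_mul_norm]
  have hu0 := norm_pos_iff.2 hu
  have hw0 := norm_pos_iff.2 hw
  refine ⟨hwu, by rw [hinner]; positivity, ?_⟩
  rw [hinner]
  calc ‖w‖ ^ 2 * ‖u‖ ^ 2 - (Real.cos θ * (‖u‖ * ‖w‖)) ^ 2
      = Real.sin θ ^ 2 * (‖u‖ * ‖w‖) ^ 2 := by
        rw [Real.sin_sq]
        ring
    _ = Real.tan θ ^ 2 * (Real.cos θ * (‖u‖ * ‖w‖)) ^ 2 := by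
        rw [← Real.tan_mul_cos hcos.ne']
        ring
    _ ≤ _ := by gcongr

/-- On the sphere the Gram bound reads `r⁴ - p² ≤ τ² p²`, so a small angle alone forces a large
inner product. -/
lemma le_inner_of_norm_eq (h : Aligned u w τ) {ε : ℝ} (hu1 : 1 ≤ ‖u‖)
    (hτ : 14 * ‖u‖ ^ 3 * τ ^ 2 ≤ ε) (hw : ‖w‖ = ‖u‖) :
    ‖u‖ ^ 2 - ‖u‖ * ε / 2 ≤ inner ℝ w u := by
  have h1 := h.gram_le
  have h2 := h.inner_le
  have h3 := h.inner_pos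
  rw [hw] at h1
  set p := inner ℝ w u
  set r := ‖u‖
  have hp2 : τ ^ 2 * p ^ 2 ≤ τ ^ 2 * (r ^ 2) ^ 2 := by gcongr
  have e1 : r ^ 2 * (r ^ 2 - p) ≤ τ ^ 2 * (r ^ 2) ^ 2 := by nlinarith
  have e2 : r ^ 2 - p ≤ τ ^ 2 * r ^ 2 := by
    refine le_of_mul_le_mul_left (e1.trans_eq ?_) (show 0 < r ^ 2 by positivity)
    ring
  have e3 : 0 ≤ τ ^ 2 * r ^ 2 := by positivity
  have e4 : τ ^ 2 * r ^ 2 * 1 ≤ τ ^ 2 * r ^ 2 * r ^ 2 := by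
    gcongr
    exact one_le_pow₀ hu1
  have e5 : r * (14 * r ^ 3 * τ ^ 2) ≤ r * ε := by gcongr
  nlinarith

lemma inner_gdStep (h : Aligned u w τ) {k : ℕ} [NeZero k] {η ε : ℝ} (hη : 0 ≤ η)
    (hX : η * contraction k u w < 1) (hε : 0 < ε) (hτ0 : 0 ≤ τ) (hτ1 : τ ≤ 1)
    (hu1 : 1 ≤ ‖u‖) (hτ : 14 * ‖u‖ ^ 3 * τ ^ 2 ≤ ε)
    (hp : inner ℝ w u ≤ ‖u‖ ^ 2 - ‖u‖ * ε / 2) :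
    ‖u‖ ^ 2 - ‖u‖ * ε / 2 ≤ inner ℝ (WeightSharing.gdStep k η u w) u ∨
      inner ℝ w u + η * (‖u‖ * ε / (4 * (1 + 4 * ‖u‖ ^ 2) ^ 4)) ≤
        inner ℝ (WeightSharing.gdStep k η u w) u := by
  have hY := (div_nonneg zero_le_one (by positivity)).trans (le_attraction k h.inner_pos.le h.norm_le)
  -- Taking `y = 0`: the alignment does not get worse.
  have hstep := h.gdStep hη hX le_rfl (mul_nonneg hη hY)
  rw [add_zero, div_one] at hstep
  obtain ⟨c, hc, hproj, hle, hc1 | hn⟩ := projBall_eq_smul h.norm_target_pos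
    ((1 - η * contraction k u w) • w + (η * attraction k u w) • u)
  · right
    have hd := h.le_drift hε hτ0 hτ1 hu1 hτ hp k
    rw [gdStep_eq, hproj, hc1, one_smul, inner_add_left, real_inner_smul_left,
      real_inner_smul_left, real_inner_self_eq_norm_sq]
    have := mul_le_mul_of_nonneg_left hd hη
    linarith
  · left
    rw [← gdStep_eq] at hn
    exact hstep.le_inner_of_norm_eq hu1 hτ hn

end Aligned

/-! ### Iteration -/

section Iteration

variable {d k : ℕ} [NeZero k] {u : EuclideanSpace ℝ (Fin d)} {η : ℝ}
  {w : ℕ → EuclideanSpace ℝ (Fin d)}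

lemma norm_iterate_le (hu : 0 < ‖u‖) (h0 : ‖w 0‖ ≤ ‖u‖)
    (hw : ∀ t, w (t + 1) = gdStep k η u (w t)) (t : ℕ) : ‖w t‖ ≤ ‖u‖ := by
  cases t with
  | zero => exact h0
  | succ t =>
    obtain ⟨c, -, -, hle, -⟩ := projBall_eq_smul hu (w t - η • gradient (objectiveWS k u) (w t))
    rw [hw, gdStep]
    exact hle

lemma aligned_iterate (hw : ∀ t, w (t + 1) = gdStep k η u (w t)) (hη : 0 ≤ η)
    (hη1 : η * (4 * (k + 3)) < 1) {y τ : ℝ} (hy : 0 ≤ y) (hyη : y ≤ η * (1 / (1 + 2 * ‖u‖ ^ 2)))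
    {t₀ : ℕ} (h : Aligned u (w t₀) τ) (n : ℕ) : Aligned u (w (t₀ + n)) (τ / (1 + y) ^ n) := by
  induction n with
  | zero => simpa using h
  | succ n ih =>
    rw [← add_assoc, hw, pow_succ, ← div_div]
    refine ih.gdStep hη (lt_of_le_of_lt ?_ hη1) hy (hyη.trans ?_)
    · exact mul_le_mul_of_nonneg_left (contraction_le k ih.inner_pos.le) hη
    · exact mul_le_mul_of_nonneg_left (le_attraction k ih.inner_pos.le ih.norm_le) hη

/-- Otherwise the inner product, positive at the start, would grow by a fixed amount `N` times and
exceed `‖u‖ ^ 2`. -/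
lemma exists_le_inner_iterate (hw : ∀ t, w (t + 1) = gdStep k η u (w t)) (hη : 0 ≤ η)
    (hη1 : η * (4 * (k + 3)) < 1) {ε τ : ℝ} (hε : 0 < ε) (hτ0 : 0 ≤ τ) (hτ1 : τ ≤ 1)
    (hu1 : 1 ≤ ‖u‖) (hτ : 14 * ‖u‖ ^ 3 * τ ^ 2 ≤ ε) {t₀ : ℕ} (h : Aligned u (w t₀) τ) {N : ℕ}
    (hN : ‖u‖ ^ 2 ≤ N * (η * (‖u‖ * ε / (4 * (1 + 4 * ‖u‖ ^ 2) ^ 4)))) :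
    ∃ n ≤ N, ‖u‖ ^ 2 - ‖u‖ * ε / 2 ≤ inner ℝ (w (t₀ + n)) u := by
  by_contra! hcon
  have hal : ∀ n, Aligned u (w (t₀ + n)) τ := fun n => by
    have := aligned_iterate hw hη hη1 le_rfl (mul_nonneg hη (by positivity)) h n
    simpa using this
  set δ := η * (‖u‖ * ε / (4 * (1 + 4 * ‖u‖ ^ 2) ^ 4))
  have hgrow : ∀ n ≤ N, inner ℝ (w t₀) u + n * δ ≤ inner ℝ (w (t₀ + n)) u := by
    intro n
    induction n with
    | zero => simp
    | succ n ih =>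
      intro hn
      have hX : η * contraction k u (w (t₀ + n)) < 1 := lt_of_le_of_lt
        (mul_le_mul_of_nonneg_left (contraction_le k (hal n).inner_pos.le) hη) hη1
      have hs := (hal n).inner_gdStep hη hX hε hτ0 hτ1 hu1 hτ (hcon n (by omega)).le
      rw [← hw] at hs
      rcases hs with hs | hs
      · exact absurd (hcon (n + 1) hn) (not_lt.2 hs)
      · rw [← add_assoc]
        push_cast
        linarith [ih (by omega)]
  have h1 := hgrow N le_rfl
  have h2 := (hal N).inner_le
  have h3 := h.inner_pos
  linarith

end Iteration

/-! ### Choice of constants and conclusion -/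

lemma norm_target_bounds {r k : ℝ} (hr : 0 ≤ r) (hk : 0 ≤ k)
    (h : r ^ 2 = 12 / Real.pi ^ 2 * k ^ 2) : k ≤ r ∧ r ≤ 2 * k := by
  have h3 := Real.pi_gt_three
  have h4 := Real.pi_lt_d2
  have e1 : 1 ≤ 12 / Real.pi ^ 2 := by
    rw [one_le_div (by positivity)]
    nlinarith
  have e2 : 12 / Real.pi ^ 2 ≤ 4 := by
    rw [div_le_iff₀ (by positivity)]
    nlinarith
  constructor
  · refine abs_le_of_sq_le_sq' ?_ hr |>.2
    rw [h]
    exact le_mul_of_one_le_left (sq_nonneg k) e1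
  · refine abs_le_of_sq_le_sq' ?_ (by positivity) |>.2
    rw [h, mul_pow]
    gcongr
    linarith

end WeightSharing

open WeightSharing in
theorem mainTheorem8 :
    ∃ P : MvPolynomial (Fin 2) ℝ,
      ∀ (k : ℕ) [NeZero k] (ε : ℝ), 0 < ε →
        ∃ η : ℝ, 0 < η ∧
          ∀ (d : ℕ) (u₀ : EuclideanSpace ℝ (Fin d)) (w : ℕ → EuclideanSpace ℝ (Fin d)),
            ‖u₀‖ ^ 2 = 12 / Real.pi ^ 2 * (k : ℝ) ^ 2 →
            ‖w 0‖ ≤ ‖u₀‖ →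
            (∀ t, w (t + 1) = WeightSharing.gdStep k η u₀ (w t)) →
            ∀ t' : ℕ,
              InnerProductGeometry.angle u₀ (w t') <
                min (Real.arctan (ε / (2 * ‖u₀‖))) (Real.sqrt (ε / ‖u₀‖)) →
              ∃ t : ℕ, t' ≤ t ∧
                (t : ℝ) ≤ (t' : ℝ) + MvPolynomial.eval ![(k : ℝ), 1 / ε] P ∧
                ‖w t - u₀‖ ≤ ε := by
  -- The first term pays for the alignment phase, the second for the radial phase, and `1` for
  -- rounding up the latter.
  refine ⟨.C 5760 * .X 0 ^ 4 + .C (10 ^ 8) * .X 0 ^ 10 * .X 1 + 1, ?_⟩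
  intro k _ ε hε
  have hk1 : (1 : ℝ) ≤ k := by exact_mod_cast NeZero.one_le
  -- This makes `η * contraction` at most `1 / 2`.
  refine ⟨1 / (8 * (k + 3)), by positivity, ?_⟩
  intro d u w hu h0 hw t' hangle
  obtain ⟨hkr, hrk⟩ := norm_target_bounds (norm_nonneg u) (by positivity) hu
  simp only [map_add, map_mul, map_pow, map_one, MvPolynomial.eval_C, MvPolynomial.eval_X,
    Matrix.cons_val_zero, Matrix.cons_val_one]
  set η : ℝ := 1 / (8 * (k + 3)) with hη
  have hη0 : 0 < η := by positivity
  have hη1 : η * (4 * (k + 3)) < 1 := by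
    rw [hη]
    field_simp
    norm_num
  have hηk : 1 / (32 * (k : ℝ)) ≤ η := by
    rw [hη]
    exact one_div_le_one_div_of_le (by positivity) (by linarith)
  have hr1 : 1 ≤ ‖u‖ := hk1.trans hkr
  have hr0 : 0 < ‖u‖ := by linarith
  have hball := norm_iterate_le hr0 h0 hw
  -- If `ε ≥ 4k`, it is at least the diameter `2‖u‖` of the ball and nothing remains to be done.
  rcases le_or_gt (4 * (k : ℝ)) ε with hbig | hsmall
  · refine ⟨t', le_rfl, le_add_of_nonneg_right (by positivity), ?_⟩
    have := norm_sub_le (w t') u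
    linarith [hball t']
  have hal := Aligned.of_angle_lt (hball t') (hangle.trans_le (min_le_left _ _))
  -- `288 = 32 * 9`, from `η ≥ 1 / (32k)` and `1 + 2‖u‖² ≤ 9k²`.
  set y : ℝ := 1 / (288 * (k : ℝ) ^ 3) with hy
  have hyη : y ≤ η * (1 / (1 + 2 * ‖u‖ ^ 2)) := by
    have h1 : 1 + 2 * ‖u‖ ^ 2 ≤ 9 * (k : ℝ) ^ 2 := by nlinarith
    calc y = 1 / (32 * (k : ℝ)) * (1 / (9 * (k : ℝ) ^ 2)) := by
          rw [hy]
          field_simp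
          norm_num
      _ ≤ _ := by gcongr
  set τ : ℝ := ε / (40 * (k : ℝ) ^ 2) with hτ
  have hal1 : Aligned u (w (t' + 5760 * k ^ 4)) τ := by
    refine (aligned_iterate hw hη0.le hη1 (by positivity) hyη hal (5760 * k ^ 4)).mono
      (by positivity) ?_
    -- Bernoulli suffices: `5760 k⁴ * y = 20k` brings the tangent bound from at most `ε / (2k)` down
    -- to `τ`.
    have hb := one_add_mul_le_pow (a := y) (by have : 0 ≤ y := by positivity
                                               linarith) (5760 * k ^ 4)
    have h1 : ((5760 * k ^ 4 : ℕ) : ℝ) * y = 20 * k := by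
      rw [hy]
      push_cast
      field_simp
      norm_num
    rw [h1] at hb
    calc ε / (2 * ‖u‖) / (1 + y) ^ (5760 * k ^ 4) ≤ ε / (2 * k) / (20 * k) := by
          gcongr
          linarith
      _ = τ := by
          rw [hτ]
          field_simp
          norm_num
  have hk2 : (k : ℝ) ≤ (k : ℝ) ^ 2 := le_self_pow₀ hk1 two_ne_zero
  have hτ0 : 0 ≤ τ := by positivity
  have hτ1 : τ ≤ 1 := by
    rw [hτ, div_le_one (by positivity)]
    linarith
  have hτε : 14 * ‖u‖ ^ 3 * τ ^ 2 ≤ ε := by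
    calc 14 * ‖u‖ ^ 3 * τ ^ 2 ≤ 14 * (2 * k) ^ 3 * τ ^ 2 := by gcongr
      _ = ε * (ε * 112 / (1600 * k)) := by
          rw [hτ]
          field_simp
          norm_num
      _ ≤ ε * 1 := by
          gcongr
          rw [div_le_one (by positivity)]
          linarith
      _ = ε := mul_one ε
  have hτr : 2 * ‖u‖ * τ ≤ ε := by
    calc 2 * ‖u‖ * τ ≤ 2 * (2 * k) * τ := by gcongr
      _ = ε * (1 / (10 * k)) := by
          rw [hτ]
          field_simp
          norm_num
      _ ≤ ε * 1 := by
          gcongr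
          rw [div_le_one (by positivity)]
          linarith
      _ = ε := mul_one ε
  -- The distance `‖u‖² ≤ 4k²` divided by the gain per step; `10 ^ 8` works because it exceeds `4 *
  -- (32 * 4 * 17 ^ 4)`.
  set N := ⌈10 ^ 8 * (k : ℝ) ^ 10 * (1 / ε)⌉₊ with hN
  have hNle : (N : ℝ) ≤ 10 ^ 8 * (k : ℝ) ^ 10 * (1 / ε) + 1 :=
    (Nat.ceil_lt_add_one (by positivity)).le
  have hNδ : ‖u‖ ^ 2 ≤ N * (η * (‖u‖ * ε / (4 * (1 + 4 * ‖u‖ ^ 2) ^ 4))) := by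
    have hM : 1 + 4 * ‖u‖ ^ 2 ≤ 17 * (k : ℝ) ^ 2 := by nlinarith
    calc ‖u‖ ^ 2 ≤ (2 * k) ^ 2 := by gcongr
      _ ≤ 10 ^ 8 / (32 * 4 * 17 ^ 4) * (k : ℝ) ^ 2 := by
          rw [mul_pow]
          gcongr
          norm_num
      _ = 10 ^ 8 * (k : ℝ) ^ 10 * (1 / ε) *
          (1 / (32 * k) * (k * ε / (4 * (17 * (k : ℝ) ^ 2) ^ 4))) := by
          field_simp
      _ ≤ _ := by
          gcongr
          exact Nat.le_ceil _
  obtain ⟨n, hnN, hn⟩ := exists_le_inner_iterate hw hη0.le hη1 hε hτ0 hτ1 hr1 hτε hal1 hNδ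
  have hal2 := aligned_iterate hw hη0.le hη1 le_rfl (mul_nonneg hη0.le (by positivity)) hal1 n
  rw [add_zero, one_pow, div_one] at hal2
  refine ⟨t' + 5760 * k ^ 4 + n, by omega, ?_, hal2.norm_sub_le hε.le hτ0 hτr hn⟩
  have hnN' : (n : ℝ) ≤ N := by exact_mod_cast hnN
  push_cast
  linarith
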